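/- Let $\Omega=\{x\in\mathbb R^3: x_3>0\}$ and let $D,\mu_A,c_f>0$, $\beta\ge 0$ be constants. Put $\operatorname{erfc}(\xi)=\frac{2}{\sqrt\pi}\int_\xi^\infty e^{-s^2}ds$ and, for $t>0$, $$K(x,y;t)=\frac{e^{-\mu_At}}{(4\pi Dt)^{3/2}}e^{-\frac{(x_1-y_1)^2+(x_2-y_2)^2}{4Dt}}\Big(e^{-\frac{(x_3+y_3)^2}{4Dt}}+e^{-\frac{(x_3-y_3)^2}{4Dt}}-2\beta\sqrt{\pi Dt}\,e^{\beta(x_3+y_3)+\beta^2Dt}\operatorname{erfc}\Big(\tfrac{x_3+y_3+2\beta Dt}{\sqrt{4Dt}}\Big)\Big),$$ the Green function of $\partial_t-D\Delta+\mu_A$ in $\Omega$ with the boundary condition $-\partial_{x_3}K+\beta K=0$ on $x_3=0$, and let $u_e(x,t;x_s)=D\,K(x,x_s;t)$ be the excitation light produced by a source at $x_s\in\partial\Omega$ at time $0$. For a cuboidal target $\mu_f=P\cdot 1_{(a_1,b_1)\times(a_2,b_2)\times(a_3,b_3)}$ the (zero-lifetime) emission light is $$u_m(x,t;x_s)=c_f\int_0^t\int_\Omega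 \mu_f(y)\,K(x,y;t-s)\,u_e(y,s;x_s)\,dy\,ds .$$ For known $b_3>a_3>0$, a time $t>0$ and five source-detector pairs $\hat\omega=\{(x_d^l,x_s^l)\in\partial\Omega\times\partial\Omega:\ l=1,\dots,5\}$, let $$M(t,\hat\omega)(a_1,b_1,a_2,b_2,P)=\big(u_m(x_d^l,t;x_s^l)\big)_{l=1}^5$$ and let $\tilde F(t,\hat\omega)=\det\nabla M(t,\hat\omega)$ be its Jacobian determinant with respect to $(a_1,b_1,a_2,b_2,P)$. **Theorem.** Let $a_1<b_1$, $a_2<b_2$ and $\kappa>0$. There is $\varepsilon>0$, depending only on these and on $D,\mu_A,\beta,c_f$, such that the following holds. Let $P>0$, $0<a_3<b_3$ with $a_3<\varepsilon$, let the sources be $x_s^l=(x_{s1}^l,x_{s2}^l,0)$ with $x^l_{sj}=(1-\theta_{lj})a_j+\theta_{lj}b_j$ ($j=1,2$, $l=1,\dots,5$), and let the detectors $x_d^l\in\partial\Omega$ satisfy $\|x_s^l-x_d^l\|<\varepsilon$ for all $l$. Assume that $$\theta_{41}\ne\theta_{42},\qquad |\theta_{1j}-1|,\ |\theta_{32}-1|,\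 |\theta_{42}-1|,\ |\theta_{2j}|,\ |\theta_{31}|,\ |\theta_{51}-\theta_{52}|<\varepsilon\quad(j=1,2),$$ and that $\kappa\le\theta_{41}\le 1-\kappa$ and $\kappa\le\theta_{51}\le1-\kappa$. Then there are $r>0$ and $t_0>0$ such that $$\tilde F(t_*,\hat\omega)(\mathbf a)\neq0\qquad\text{for all } 0<t_*<t_0 \text{ and all } \mathbf a\in B_r\big((a_1,b_1,a_2,b_2,P)\big)\subset\mathbb R^5 .$$ -/

import Mathlib

open scoped Real

namespace FDOT

noncomputable section

/-- The complementary error function `erfc ξ = (2/√π) ∫_ξ^∞ e^{-s²} ds`. -/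
def erfc (ξ : ℝ) : ℝ := 2 / √π * ∫ s in Set.Ioi ξ, Real.exp (-s ^ 2)

/-- The physical constants of the diffusion model: diffusion coefficient `D`, absorption `μA`,
Robin coefficient `β` and the constant `cf` (speed of light times quantum efficiency). -/
structure Medium where
  D : ℝ
  μA : ℝ
  β : ℝ
  cf : ℝ
  D_pos : 0 < D
  μA_pos : 0 < μA
  β_nonneg : 0 ≤ β
  cf_pos : 0 < cf

/-- The half space `x₃ > 0` (coordinates are numbered `0, 1, 2`). -/
def halfSpace : Set (Fin 3 → ℝ) := {x | 0 < x 2}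

/-- The point of the boundary plane `x₃ = 0` with tangential coordinates `p`. -/
def bdryPoint (p : EuclideanSpace ℝ (Fin 2)) : Fin 3 → ℝ := ![p 0, p 1, 0]

/-- The vertical factor `K₃(x₃, y₃; t)` of the Green function. -/
def K3 (m : Medium) (x₃ y₃ t : ℝ) : ℝ :=
  Real.exp (-(x₃ + y₃) ^ 2 / (4 * m.D * t)) + Real.exp (-(x₃ - y₃) ^ 2 / (4 * m.D * t))
    - 2 * m.β * √(π * m.D * t) * Real.exp (m.β * (x₃ + y₃) + m.β ^ 2 * m.D * t)
      * erfc ((x₃ + y₃ + 2 * m.β * m.D * t) / √(4 * m.D * t))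

/-- The Green function `K(x, y; t)`, `t > 0`, of `∂ₜ - DΔ + μA` in the half space with the Robin
boundary condition `v·∇K + βK = 0`, where `v` is the outward unit normal. -/
def K (m : Medium) (x y : Fin 3 → ℝ) (t : ℝ) : ℝ :=
  Real.exp (-m.μA * t) / (4 * π * m.D * t) ^ (3 / 2 : ℝ)
    * Real.exp (-((x 0 - y 0) ^ 2 + (x 1 - y 1) ^ 2) / (4 * m.D * t)) * K3 m (x 2) (y 2) t

/-- The excitation light `u_e(x, t; x_s)` generated by a point source on the boundary at time `0`. -/
def excitation (m : Medium) (x : Fin 3 → ℝ) (t : ℝ) (xs : Fin 3 → ℝ) : ℝ :=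
  m.D * Real.exp (-m.μA * t) / (4 * π * m.D * t) ^ (3 / 2 : ℝ)
    * Real.exp (-((x 0 - xs 0) ^ 2 + (x 1 - xs 1) ^ 2) / (4 * m.D * t))
    * (2 * Real.exp (-(x 2) ^ 2 / (4 * m.D * t))
      - 2 * m.β * √(π * m.D * t) * Real.exp (m.β * x 2 + m.β ^ 2 * m.D * t)
        * erfc ((x 2 + 2 * m.β * m.D * t) / √(4 * m.D * t)))

/-- The zero-lifetime emission light
`c_f ∫₀ᵗ ∫_Ω μ_f(y) K(x, y; t - s) u_e(y, s; x_s) dy ds` for a fluorophore absorption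
coefficient `μf`. -/
def emission (m : Medium) (μf : (Fin 3 → ℝ) → ℝ) (x : Fin 3 → ℝ) (t : ℝ) (xs : Fin 3 → ℝ) : ℝ :=
  m.cf * ∫ s in (0 : ℝ)..t, ∫ y in halfSpace, μf y * K m x y (t - s) * excitation m y s xs

/-- The cuboid `(a₁, b₁) × (a₂, b₂) × (a₃, b₃)` inside the half space. -/
def cuboid (a₁ b₁ a₂ b₂ a₃ b₃ : ℝ) : Set (Fin 3 → ℝ) :=
  {y | y ∈ halfSpace ∧ y 0 ∈ Set.Ioo a₁ b₁ ∧ y 1 ∈ Set.Ioo a₂ b₂ ∧ y 2 ∈ Set.Ioo a₃ b₃}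

/-- The absorption coefficient of a cuboidal target: `P` in the cuboid and `0` elsewhere. -/
def target (a₁ b₁ a₂ b₂ a₃ b₃ P : ℝ) : (Fin 3 → ℝ) → ℝ :=
  (cuboid a₁ b₁ a₂ b₂ a₃ b₃).indicator fun _ => P

/-- The reduced measurement map: for known `a₃, b₃`, time `t`, detectors `xd l` and sources `xs l`
on the boundary, it sends `(a₁, b₁, a₂, b₂, P)` to the five values of the emission light at the
detectors. -/
def measurement (m : Medium) (a₃ b₃ t : ℝ) (xd xs : Fin 5 → EuclideanSpace ℝ (Fin 2))
    (p : EuclideanSpace ℝ (Fin 5)) : EuclideanSpace ℝ (Fin 5) :=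
  WithLp.toLp 2 fun l =>
    emission m (target (p 0) (p 1) (p 2) (p 3) a₃ b₃ (p 4)) (bdryPoint (xd l)) t (bdryPoint (xs l))

/-- The reduced Jacobian determinant: the determinant of the Fréchet derivative of the reduced
measurement map with respect to `(a₁, b₁, a₂, b₂, P)`. (Where the map is not differentiable,
Mathlib's derivative is the zero map and the value is `0`; so a nonzero value includes
differentiability.) -/
def jacobianDet (m : Medium) (a₃ b₃ t : ℝ) (xd xs : Fin 5 → EuclideanSpace ℝ (Fin 2))
    (p : EuclideanSpace ℝ (Fin 5)) : ℝ :=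
  (fderiv ℝ (measurement m a₃ b₃ t xd xs) p).det

/-- The boundary point with tangential coordinates `(1 - θⱼ) aⱼ + θⱼ bⱼ`, `j = 1, 2`. -/
def sourcePoint (a b θ : Fin 2 → ℝ) : EuclideanSpace ℝ (Fin 2) :=
  WithLp.toLp 2 fun j => (1 - θ j) * a j + θ j * b j

/-- The `θ`-conditions with tolerance `ε`; `θ l j` is the parameter `θ_{l+1, j+1}`. -/
structure ThetaCondition (ε : ℝ) (θ : Fin 5 → Fin 2 → ℝ) : Prop where
  ne : θ 3 0 ≠ θ 3 1
  first : ∀ j, |θ 0 j - 1| < ε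
  second : ∀ j, |θ 1 j| < ε
  third_fst : |θ 2 0| < ε
  third_snd : |θ 2 1 - 1| < ε
  fourth_snd : |θ 3 1 - 1| < ε
  fifth : |θ 4 0 - θ 4 1| < ε

end

end FDOT

namespace FDOT

open scoped Real
open MeasureTheory Set Filter Topology

/-! The Green function separates in the three coordinates. For a cuboid the emission light is
therefore `cf * P` times a time integral of a vertical `weight` against two one-dimensional
tangential integrals (`emission_eq`). Differentiating in a face coordinate replaces the integral in
that direction by plus or minus its integrand at the face; differentiating in `P` removes the factor
`P` (`hasFDerivAt_emission`).

For small `t` only exponential rates matter. If a source is at distance at least `ρ` from the face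
moved by a parameter, that partial derivative is at most a constant times `exp (-(γ / t))`, with `γ
= ρ ^ 2 / (4 * D)` (`abs_emissionGrad_le_exp`). If source, detector and a piece of the relevant part
of the cuboid lie within tangential distance `δ`, and this piece lies at depth at most `δ`, the
partial derivative is at least a constant times `t * exp (-(η / t))`, with `η = 6 * δ ^ 2 / D`
(`le_abs_emissionGrad`). The constants may depend on `a₃` and `P`, but not on `t`.

The five sources lie near the corners `(b₁, b₂)`, `(a₁, a₂)`, `(a₁, b₂)`, near the edge `x₂ = b₂`
away from its ends, and well inside the rectangle. With columns ordered `b₁, a₂, a₁, b₂, P`, each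
source is close to what its own column detects and far from the faces of all earlier columns.
Entries below the diagonal are thus exponentially small, and those above it are merely bounded. In
the Leibniz formula every permutation except the identity uses an entry below the diagonal
(`det_ne_zero_of_lower_le`). The diagonal product wins for small `t` as soon as `5 * η < γ`, which
is what the choice of `ε` secures. The estimates tolerate moving the parameters by `r ≤ ε`, so one
`t₀` serves the whole ball. -/

/-! ### Bounds for `erfc` and for the vertical factor -/

lemma integrable_exp_neg_sq : Integrable fun s : ℝ => Real.exp (-s ^ 2) := by
  simpa using integrable_exp_neg_mul_sq (b := 1) one_pos

lemma erfc_nonneg (z : ℝ) : 0 ≤ erfc z :=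
  mul_nonneg (by positivity) (integral_nonneg fun _ => (Real.exp_pos _).le)

lemma measurable_erfc : Measurable erfc := by
  refine Antitone.measurable fun x y hxy => ?_
  refine mul_le_mul_of_nonneg_left ?_ (by positivity)
  exact setIntegral_mono_set integrable_exp_neg_sq.integrableOn
    (ae_of_all _ fun _ => (Real.exp_pos _).le) (LE.le.eventuallyLE (Ioi_subset_Ioi hxy))

/-- On `s > z` the integrand is at most `(s / z) * exp (-s ^ 2)`, which has an explicit primitive.
-/
lemma erfc_le {z : ℝ} (hz : 0 < z) : erfc z ≤ Real.exp (-z ^ 2) / (√π * z) := by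
  have hd : ∀ x ∈ Ici z,
      HasDerivAt (fun s : ℝ => -(Real.exp (-s ^ 2) / (2 * z))) (x / z * Real.exp (-x ^ 2)) x := by
    intro x _
    have h := (((hasDerivAt_pow 2 x).neg.exp).div_const (2 * z)).neg
    refine h.congr_deriv ?_
    simp
    field_simp
  have hpos : ∀ x ∈ Ioi z, 0 ≤ x / z * Real.exp (-x ^ 2) := fun x hx =>
    mul_nonneg (div_nonneg (hz.le.trans (le_of_lt hx)) hz.le) (Real.exp_pos _).le
  have hlim : Tendsto (fun s : ℝ => -(Real.exp (-s ^ 2) / (2 * z))) atTop (𝓝 0) := by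
    have h1 : Tendsto (fun s : ℝ => Real.exp (-s ^ 2)) atTop (𝓝 0) :=
      Real.tendsto_exp_neg_atTop_nhds_zero.comp (tendsto_pow_atTop two_ne_zero)
    simpa using (h1.div_const (2 * z)).neg
  have hi := integrableOn_Ioi_deriv_of_nonneg' hd hpos hlim
  have he := integral_Ioi_of_hasDerivAt_of_nonneg' hd hpos hlim
  have hle : ∫ s in Ioi z, Real.exp (-s ^ 2) ≤ Real.exp (-z ^ 2) / (2 * z) := by
    calc ∫ s in Ioi z, Real.exp (-s ^ 2)
        ≤ ∫ s in Ioi z, s / z * Real.exp (-s ^ 2) := by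
          refine setIntegral_mono_on integrable_exp_neg_sq.integrableOn hi measurableSet_Ioi ?_
          intro x hx
          have : 1 ≤ x / z := (one_le_div hz).2 (le_of_lt hx)
          nlinarith [Real.exp_pos (-x ^ 2)]
      _ = _ := by rw [he]; ring
  have hpi : 0 < √π := Real.sqrt_pos.2 Real.pi_pos
  calc erfc z ≤ 2 / √π * (Real.exp (-z ^ 2) / (2 * z)) :=
        mul_le_mul_of_nonneg_left hle (by positivity)
    _ = _ := by field_simp

/-- The vertical factor of the Green function for a point of the boundary plane. -/
noncomputable def vert (m : Medium) (y τ : ℝ) : ℝ := K3 m 0 y τ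

lemma vert_eq (m : Medium) (y τ : ℝ) :
    vert m y τ = 2 * Real.exp (-y ^ 2 / (4 * m.D * τ))
      - 2 * m.β * √(π * m.D * τ) * Real.exp (m.β * y + m.β ^ 2 * m.D * τ)
        * erfc ((y + 2 * m.β * m.D * τ) / √(4 * m.D * τ)) := by
  simp only [vert, K3, zero_add, zero_sub, neg_sq]
  ring

lemma measurable_vert {α : Type*} [MeasurableSpace α] {f g : α → ℝ} (hf : Measurable f)
    (hg : Measurable g) (m : Medium) : Measurable fun x => vert m (f x) (g x) := by
  simp only [vert_eq]
  have := measurable_erfc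
  fun_prop

lemma vert_le (m : Medium) (y τ : ℝ) :
    vert m y τ ≤ 2 * Real.exp (-y ^ 2 / (4 * m.D * τ)) := by
  have := erfc_nonneg ((y + 2 * m.β * m.D * τ) / √(4 * m.D * τ))
  have := m.β_nonneg
  rw [vert_eq, sub_le_self_iff]
  positivity

/-- The Robin correction cancels the leading Gaussian only partially: by `erfc_le` it is at most the
fraction `2βDτ / (y + 2βDτ)` of it. This gives positivity, and for small `τ` a lower bound by a
Gaussian. -/
lemma le_vert_aux (m : Medium) {y τ : ℝ} (hy : 0 < y) (hτ : 0 < τ) :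
    2 * Real.exp (-y ^ 2 / (4 * m.D * τ)) * (y / (y + 2 * m.β * m.D * τ)) ≤ vert m y τ := by
  have hD := m.D_pos
  have hβ := m.β_nonneg
  have hn : 0 < y + 2 * m.β * m.D * τ := by positivity
  set q := √(m.D * τ) with hq
  have hq0 : 0 < q := Real.sqrt_pos.2 (by positivity)
  have hq2 : q ^ 2 = m.D * τ := Real.sq_sqrt (by positivity)
  have h4 : √(4 * m.D * τ) = 2 * q := by
    rw [mul_assoc, Real.sqrt_mul (by norm_num), show (4 : ℝ) = 2 ^ 2 by norm_num,
      Real.sqrt_sq (by norm_num)]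
  have hp : √(π * m.D * τ) = √π * q := by
    rw [mul_assoc, Real.sqrt_mul Real.pi_pos.le]
  set z := (y + 2 * m.β * m.D * τ) / √(4 * m.D * τ) with hz
  have hz0 : 0 < z := by rw [hz, h4]; positivity
  have hpi : 0 < √π := Real.sqrt_pos.2 Real.pi_pos
  -- Completing the square: the growing exponential is exactly absorbed by the Gaussian in the bound
  -- for `erfc`.
  have he : Real.exp (m.β * y + m.β ^ 2 * m.D * τ) * Real.exp (-z ^ 2)
      = Real.exp (-y ^ 2 / (4 * m.D * τ)) := by
    rw [← Real.exp_add]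
    congr 1
    rw [hz, h4, div_pow, mul_pow, hq2]
    field_simp
    ring
  have hsub : 2 * m.β * √(π * m.D * τ) * Real.exp (m.β * y + m.β ^ 2 * m.D * τ) * erfc z
      ≤ 2 * Real.exp (-y ^ 2 / (4 * m.D * τ))
        * (2 * m.β * m.D * τ / (y + 2 * m.β * m.D * τ)) := by
    calc _ ≤ 2 * m.β * √(π * m.D * τ) * Real.exp (m.β * y + m.β ^ 2 * m.D * τ)
            * (Real.exp (-z ^ 2) / (√π * z)) :=
          mul_le_mul_of_nonneg_left (erfc_le hz0) (by positivity)
      _ = 2 * m.β * √(π * m.D * τ) * (Real.exp (m.β * y + m.β ^ 2 * m.D * τ)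
            * Real.exp (-z ^ 2)) / (√π * z) := by ring
      _ = _ := by
          rw [he, hp, hz, h4]
          have : 2 * m.β * m.D * τ = 2 * m.β * q ^ 2 := by rw [hq2]; ring
          rw [this] at hn ⊢
          field_simp
  rw [vert_eq]
  have : y / (y + 2 * m.β * m.D * τ) = 1 - 2 * m.β * m.D * τ / (y + 2 * m.β * m.D * τ) := by
    field_simp; ring
  rw [this]
  linarith

lemma vert_nonneg (m : Medium) {y τ : ℝ} (hy : 0 < y) (hτ : 0 < τ) : 0 ≤ vert m y τ := by
  have hD := m.D_pos
  have hβ := m.β_nonneg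
  exact le_trans (by positivity) (le_vert_aux m hy hτ)

lemma le_vert (m : Medium) {y τ : ℝ} (hy : 0 < y) (hτ : 0 < τ) (h : 2 * m.β * m.D * τ ≤ y) :
    Real.exp (-y ^ 2 / (4 * m.D * τ)) ≤ vert m y τ := by
  have hD := m.D_pos
  have hβ := m.β_nonneg
  refine le_trans ?_ (le_vert_aux m hy hτ)
  have : 1 / 2 ≤ y / (y + 2 * m.β * m.D * τ) := by
    rw [div_le_div_iff₀ (by norm_num) (by positivity)]; linarith
  nlinarith [Real.exp_pos (-y ^ 2 / (4 * m.D * τ))]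

/-! ### The vertical weight in time -/

/-- The space-independent part of the heat kernel. -/
noncomputable def heat (m : Medium) (τ : ℝ) : ℝ :=
  Real.exp (-m.μA * τ) / (4 * π * m.D * τ) ^ (3 / 2 : ℝ)

lemma heat_nonneg (m : Medium) {τ : ℝ} (hτ : 0 < τ) : 0 ≤ heat m τ := by
  have := m.D_pos
  unfold heat
  positivity

lemma measurable_heat (m : Medium) : Measurable (heat m) := by
  unfold heat
  fun_prop

lemma le_heat (m : Medium) {τ : ℝ} (hτ : 0 < τ) (hτ1 : τ ≤ 1) : heat m 1 ≤ heat m τ := by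
  have := m.D_pos
  have := m.μA_pos
  unfold heat
  gcongr ?_ / ?_
  · exact Real.exp_le_exp.2 (by nlinarith)
  · exact Real.rpow_le_rpow (by positivity) (by gcongr) (by norm_num)

lemma rpow_mul_exp_neg_le {k u : ℝ} (hk : 0 < k) (hu : 0 ≤ u) :
    u ^ (3 / 2 : ℝ) * Real.exp (-(k * u)) ≤ 1 + 2 / k ^ 2 := by
  have h1 : u ^ (3 / 2 : ℝ) ≤ 1 + u ^ 2 := by
    rcases le_total u 1 with h | h
    · have := Real.rpow_le_one hu h (by norm_num : (0 : ℝ) ≤ 3 / 2)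
      nlinarith [sq_nonneg u]
    · have := Real.rpow_le_rpow_of_exponent_le h (by norm_num : (3 / 2 : ℝ) ≤ 2)
      rw [Real.rpow_two] at this
      linarith
  have h2 := Real.quadratic_le_exp_of_nonneg (mul_nonneg hk.le hu)
  have h3 : 1 + u ^ 2 ≤ (1 + 2 / k ^ 2) * Real.exp (k * u) := by
    have h4 : u ^ 2 ≤ 2 / k ^ 2 * Real.exp (k * u) := by
      rw [div_mul_eq_mul_div, le_div_iff₀ (by positivity)]
      nlinarith [mul_nonneg hk.le hu]
    have : 1 ≤ Real.exp (k * u) := Real.one_le_exp (mul_nonneg hk.le hu)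
    linarith
  rw [Real.exp_neg, ← div_eq_mul_inv, div_le_iff₀ (Real.exp_pos _)]
  exact h1.trans h3

/-- Positive depth `a` removes the singularity at `τ = 0`: with `u = 1 / (4πDτ)` the Gaussian is
`exp (-(π * a ^ 2 * u))`, which beats `u ^ (3 / 2)`. -/
lemma exists_heat_mul_exp_le (m : Medium) {a : ℝ} (ha : 0 < a) :
    ∃ C > 0, ∀ τ > 0, heat m τ * Real.exp (-a ^ 2 / (4 * m.D * τ)) ≤ C := by
  have hD := m.D_pos
  have hμ := m.μA_pos
  have hk : 0 < π * a ^ 2 := by positivity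
  refine ⟨1 + 2 / (π * a ^ 2) ^ 2, by positivity, fun τ hτ => ?_⟩
  have hX : 0 < 4 * π * m.D * τ := by positivity
  refine le_trans ?_ (rpow_mul_exp_neg_le hk (inv_pos.2 hX).le)
  unfold heat
  rw [Real.inv_rpow hX.le, div_eq_mul_inv]
  have he : -a ^ 2 / (4 * m.D * τ) = -(π * a ^ 2 * (4 * π * m.D * τ)⁻¹) := by
    field_simp
  rw [he]
  gcongr
  refine mul_le_of_le_one_left (by positivity) (Real.exp_le_one_iff.2 ?_)
  nlinarith

/-- The vertical part of the space-time integrand of the emission light. -/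
noncomputable def weight (m : Medium) (a₃ b₃ t s : ℝ) : ℝ :=
  m.D * heat m (t - s) * heat m s * ∫ y in a₃..b₃, vert m y (t - s) * vert m y s

lemma measurable_intervalIntegral {f : ℝ → ℝ → ℝ} (hf : Measurable (Function.uncurry f))
    (a b : ℝ) : Measurable fun s => ∫ y in a..b, f s y := by
  simp only [intervalIntegral]
  exact (hf.stronglyMeasurable.integral_prod_right.sub
    hf.stronglyMeasurable.integral_prod_right).measurable

lemma measurable_weight (m : Medium) (a₃ b₃ t : ℝ) : Measurable (weight m a₃ b₃ t) := by
  have h1 := measurable_heat m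
  have h2 : Measurable (Function.uncurry fun s y => vert m y (t - s) * vert m y s) :=
    (measurable_vert measurable_snd (measurable_const.sub measurable_fst) m).mul
      (measurable_vert measurable_snd measurable_fst m)
  have h3 := measurable_intervalIntegral h2 a₃ b₃
  exact ((measurable_const.mul (h1.comp (measurable_const.sub measurable_id))).mul h1).mul h3

lemma vert_mul_le (m : Medium) {a y τ s : ℝ} (ha : 0 < a) (hy : a ≤ y) (hτ : 0 < τ)
    (hs : 0 < s) : vert m y τ * vert m y s ≤
      4 * (Real.exp (-a ^ 2 / (4 * m.D * τ)) * Real.exp (-a ^ 2 / (4 * m.D * s))) := by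
  have hD := m.D_pos
  have hy0 : 0 < y := ha.trans_le hy
  have h : ∀ r > 0, vert m y r ≤ 2 * Real.exp (-a ^ 2 / (4 * m.D * r)) := fun r hr => by
    refine (vert_le m y r).trans ?_
    gcongr
  calc _ ≤ (2 * Real.exp (-a ^ 2 / (4 * m.D * τ))) * (2 * Real.exp (-a ^ 2 / (4 * m.D * s))) :=
        mul_le_mul (h τ hτ) (h s hs) (vert_nonneg m hy0 hs) (by positivity)
    _ = _ := by ring

lemma weight_nonneg (m : Medium) {a₃ b₃ t s : ℝ} (ha : 0 < a₃) (hab : a₃ ≤ b₃)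
    (hs : s ∈ Ioo 0 t) : 0 ≤ weight m a₃ b₃ t s := by
  have hD := m.D_pos
  have h1 : 0 < t - s := sub_pos.2 hs.2
  refine mul_nonneg (mul_nonneg (mul_nonneg hD.le (heat_nonneg m h1)) (heat_nonneg m hs.1)) ?_
  exact intervalIntegral.integral_nonneg hab fun y hy =>
    mul_nonneg (vert_nonneg m (ha.trans_le hy.1) h1) (vert_nonneg m (ha.trans_le hy.1) hs.1)

/-- Since the target stays at depth at least `a₃ > 0`, both heat singularities, at `s = 0` and at `s
= t`, are damped uniformly in `t`. -/
lemma exists_weight_le (m : Medium) {a₃ b₃ : ℝ} (ha : 0 < a₃) (hab : a₃ ≤ b₃) :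
    ∃ C > 0, ∀ t, ∀ s ∈ Ioo 0 t, weight m a₃ b₃ t s ≤ C := by
  have hD := m.D_pos
  obtain ⟨C, hC, h⟩ := exists_heat_mul_exp_le m ha
  refine ⟨m.D * C * C * (4 * (b₃ - a₃)) + 1, ?_, fun t s hs => ?_⟩
  · have := sub_nonneg.2 hab
    positivity
  have h1 : 0 < t - s := sub_pos.2 hs.2
  have hint : ∫ y in a₃..b₃, vert m y (t - s) * vert m y s ≤
      4 * (Real.exp (-a₃ ^ 2 / (4 * m.D * (t - s))) * Real.exp (-a₃ ^ 2 / (4 * m.D * s)))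
        * (b₃ - a₃) := by
    refine (le_abs_self _).trans ?_
    have := intervalIntegral.norm_integral_le_of_norm_le_const (a := a₃) (b := b₃)
      (f := fun y => vert m y (t - s) * vert m y s)
      (C := 4 * (Real.exp (-a₃ ^ 2 / (4 * m.D * (t - s))) * Real.exp (-a₃ ^ 2 / (4 * m.D * s))))
      ?_
    · rwa [abs_of_nonneg (sub_nonneg.2 hab)] at this
    · intro y hy
      rw [uIoc_of_le hab] at hy
      have hy0 := ha.trans hy.1
      rw [Real.norm_of_nonneg (mul_nonneg (vert_nonneg m hy0 h1) (vert_nonneg m hy0 hs.1))]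
      exact vert_mul_le m ha hy.1.le h1 hs.1
  have hp := heat_nonneg m h1
  have hq := heat_nonneg m hs.1
  calc weight m a₃ b₃ t s ≤ m.D * heat m (t - s) * heat m s * _ :=
        mul_le_mul_of_nonneg_left hint (by positivity)
    _ = m.D * (heat m (t - s) * Real.exp (-a₃ ^ 2 / (4 * m.D * (t - s))))
        * (heat m s * Real.exp (-a₃ ^ 2 / (4 * m.D * s))) * (4 * (b₃ - a₃)) := by ring
    _ ≤ m.D * C * C * (4 * (b₃ - a₃)) := by
        have := sub_nonneg.2 hab
        gcongr
        · exact h _ h1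
        · exact h _ hs.1
    _ ≤ _ := by linarith

lemma exp_neg_sq_div_le (m : Medium) {x δ t τ : ℝ} (ht : 0 < t) (hτ : t / 4 ≤ τ)
    (hx : |x| ≤ δ) : Real.exp (-(δ ^ 2 / (m.D * t))) ≤ Real.exp (-x ^ 2 / (4 * m.D * τ)) := by
  have hD := m.D_pos
  have hτ0 : 0 < τ := by linarith
  rw [Real.exp_le_exp, neg_div, neg_le_neg_iff]
  have : x ^ 2 ≤ δ ^ 2 := sq_le_sq' (abs_le.1 hx).1 (abs_le.1 hx).2
  apply div_le_div₀ (sq_nonneg _) this (by positivity)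
  nlinarith

/-- Only depths in `[a₃, h]` are kept, so the exponential cost is governed by `h` and not by `b₃`.
For `s` in the middle half of `[0, t]` both elapsed times are at least `t / 4`, which turns `4 * D *
τ` into `D * t` in each of the two Gaussians. -/
lemma le_weight (m : Medium) {a₃ b₃ h t s : ℝ} (ha : 0 < a₃) (hah : a₃ ≤ h) (hb : h ≤ b₃)
    (ht : 0 < t) (ht1 : t ≤ 1) (hβ : 2 * m.β * m.D * t ≤ a₃) (hs : s ∈ Icc (t / 4) (3 * t / 4)) :
    m.D * heat m 1 ^ 2 * ((h - a₃) * Real.exp (-(2 * h ^ 2 / (m.D * t)))) ≤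
      weight m a₃ b₃ t s := by
  have hD := m.D_pos
  have hβ0 := m.β_nonneg
  have hs0 : 0 < s := by linarith [hs.1]
  have h1 : 0 < t - s := by linarith [hs.2]
  have hi : ∀ a b, a₃ ≤ a → a ≤ b →
      IntervalIntegrable (fun y => vert m y (t - s) * vert m y s) volume a b := by
    intro a b ha' hab'
    refine (intervalIntegrable_const (c := 4 *
      (Real.exp (-a₃ ^ 2 / (4 * m.D * (t - s))) * Real.exp (-a₃ ^ 2 / (4 * m.D * s))))).mono_fun'
      ((measurable_vert measurable_id measurable_const m).mul
        (measurable_vert measurable_id measurable_const m)).aestronglyMeasurable ?_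
    refine (ae_restrict_iff' measurableSet_uIoc).2 (ae_of_all _ fun y hy => ?_)
    rw [uIoc_of_le hab'] at hy
    beta_reduce
    have hy1 : a₃ ≤ y := ha'.trans hy.1.le
    have hy0 := ha.trans_le hy1
    rw [Real.norm_of_nonneg (mul_nonneg (vert_nonneg m hy0 h1) (vert_nonneg m hy0 hs0))]
    exact vert_mul_le m ha hy1 h1 hs0
  have hlow : (h - a₃) * Real.exp (-(2 * h ^ 2 / (m.D * t))) ≤
      ∫ y in a₃..b₃, vert m y (t - s) * vert m y s := by
    rw [← intervalIntegral.integral_add_adjacent_intervals (hi a₃ h le_rfl hah) (hi h b₃ hah hb)]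
    have hnn : 0 ≤ ∫ y in h..b₃, vert m y (t - s) * vert m y s :=
      intervalIntegral.integral_nonneg hb fun y hy =>
        have hy0 := ha.trans_le (hah.trans hy.1)
        mul_nonneg (vert_nonneg m hy0 h1) (vert_nonneg m hy0 hs0)
    refine le_add_of_le_of_nonneg ?_ hnn
    have := intervalIntegral.integral_mono_on hah
      (intervalIntegrable_const (c := Real.exp (-(2 * h ^ 2 / (m.D * t))))) (hi a₃ h le_rfl hah) ?_
    · simpa using this
    · intro y hy
      have hy0 := ha.trans_le hy.1
      have hyh : |y| ≤ h := by rw [abs_of_pos hy0]; exact hy.2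
      have hv : ∀ τ, t / 4 ≤ τ → τ ≤ t → Real.exp (-(h ^ 2 / (m.D * t))) ≤ vert m y τ := by
        intro τ hτ hτt
        refine (exp_neg_sq_div_le m ht hτ hyh).trans (le_vert m hy0 (by linarith) ?_)
        refine le_trans ?_ (hβ.trans hy.1)
        gcongr
      calc _ = Real.exp (-(h ^ 2 / (m.D * t))) * Real.exp (-(h ^ 2 / (m.D * t))) := by
            rw [← Real.exp_add]; congr 1; ring
        _ ≤ _ := mul_le_mul (hv _ (by linarith [hs.2]) (by linarith)) (hv _ hs.1 (by linarith [hs.2]))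
            (Real.exp_pos _).le (vert_nonneg m hy0 h1)
  have hp := heat_nonneg m one_pos
  calc _ = m.D * heat m 1 * heat m 1 * ((h - a₃) * Real.exp (-(2 * h ^ 2 / (m.D * t)))) := by ring
    _ ≤ _ := by
      have := sub_nonneg.2 hah
      have := heat_nonneg m h1
      have := heat_nonneg m hs0
      unfold weight
      gcongr
      · exact le_heat m h1 (by linarith)
      · exact le_heat m hs0 (by linarith [hs.2])

/-! ### Tangential factors -/

/-- A tangential factor of the space-time integrand of the emission light, for a detector at `u`
and a source at `v`. -/
noncomputable def profile (m : Medium) (t u v s y : ℝ) : ℝ :=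
  Real.exp (-(u - y) ^ 2 / (4 * m.D * (t - s))) * Real.exp (-(y - v) ^ 2 / (4 * m.D * s))

lemma measurable_profile (m : Medium) (t u v : ℝ) :
    Measurable (Function.uncurry (profile m t u v)) := by
  unfold profile Function.uncurry
  fun_prop

lemma continuous_profile (m : Medium) (t u v s : ℝ) : Continuous (profile m t u v s) := by
  unfold profile
  fun_prop

lemma profile_nonneg (m : Medium) (t u v s y : ℝ) : 0 ≤ profile m t u v s y := by
  unfold profile; positivity

/-- The source factor alone suffices, because `s < t`; the detector factor is bounded by one. -/
lemma profile_le_exp (m : Medium) {t u v s y ρ : ℝ} (hs : s ∈ Ioo 0 t) (hρ : 0 ≤ ρ)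
    (hy : ρ ≤ |v - y|) : profile m t u v s y ≤ Real.exp (-(ρ ^ 2 / (4 * m.D * t))) := by
  have hD := m.D_pos
  have h1 : 0 < t - s := sub_pos.2 hs.2
  have hs0 := hs.1
  have hq : ρ ^ 2 ≤ (y - v) ^ 2 := by
    rw [← sq_abs (y - v), abs_sub_comm]
    gcongr
  refine (mul_le_of_le_one_left (Real.exp_pos _).le (Real.exp_le_one_iff.2 ?_)).trans ?_
  · rw [neg_div, neg_nonpos]; positivity
  · rw [Real.exp_le_exp, neg_div, neg_le_neg_iff]
    apply div_le_div₀ (sq_nonneg _) hq (by positivity)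
    gcongr
    exact hs.2.le

lemma profile_le_one (m : Medium) {t u v s : ℝ} (hs : s ∈ Ioo 0 t) (y : ℝ) :
    profile m t u v s y ≤ 1 := by
  simpa using profile_le_exp m (u := u) (v := v) (y := y) hs le_rfl (abs_nonneg _)

lemma le_profile (m : Medium) {t u v s y δ : ℝ} (ht : 0 < t) (hs : s ∈ Icc (t / 4) (3 * t / 4))
    (hu : |u - y| ≤ δ) (hv : |y - v| ≤ δ) :
    Real.exp (-(2 * δ ^ 2 / (m.D * t))) ≤ profile m t u v s y := by
  calc _ = Real.exp (-(δ ^ 2 / (m.D * t))) * Real.exp (-(δ ^ 2 / (m.D * t))) := by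
        rw [← Real.exp_add]; congr 1; ring
    _ ≤ _ := mul_le_mul (exp_neg_sq_div_le m ht (by linarith [hs.2]) hu)
        (exp_neg_sq_div_le m ht hs.1 hv) (Real.exp_pos _).le (Real.exp_pos _).le

lemma integral_profile_nonneg (m : Medium) (t u v s : ℝ) {x₀ x₁ : ℝ} (h : x₀ ≤ x₁) :
    0 ≤ ∫ y in x₀..x₁, profile m t u v s y :=
  intervalIntegral.integral_nonneg h fun _ _ => profile_nonneg _ _ _ _ _ _

lemma integral_profile_le (m : Medium) {t u v s x₀ x₁ : ℝ} (hs : s ∈ Ioo 0 t) (h : x₀ ≤ x₁) :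
    ∫ y in x₀..x₁, profile m t u v s y ≤ x₁ - x₀ := by
  have := intervalIntegral.integral_mono_on h
    ((continuous_profile m t u v s).intervalIntegrable (μ := volume) x₀ x₁)
    (intervalIntegrable_const (c := (1 : ℝ))) fun y _ => profile_le_one m hs y
  simpa using this

lemma le_integral_profile (m : Medium) {t u v s x₀ x₁ c d δ : ℝ} (ht : 0 < t)
    (hs : s ∈ Icc (t / 4) (3 * t / 4)) (h0 : x₀ ≤ c) (hcd : c ≤ d) (h1 : d ≤ x₁)
    (hu : ∀ y ∈ Icc c d, |u - y| ≤ δ) (hv : ∀ y ∈ Icc c d, |y - v| ≤ δ) :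
    (d - c) * Real.exp (-(2 * δ ^ 2 / (m.D * t))) ≤ ∫ y in x₀..x₁, profile m t u v s y := by
  have hi := fun a b => (continuous_profile m t u v s).intervalIntegrable (μ := volume) a b
  have := intervalIntegral.integral_mono_on hcd
    (intervalIntegrable_const (c := Real.exp (-(2 * δ ^ 2 / (m.D * t))))) (hi c d)
    fun y hy => le_profile m ht hs (hu y hy) (hv y hy)
  rw [← intervalIntegral.integral_add_adjacent_intervals (hi x₀ c) (hi c x₁),
    ← intervalIntegral.integral_add_adjacent_intervals (hi c d) (hi d x₁)]
  have e1 := integral_profile_nonneg m t u v s h0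
  have e2 := integral_profile_nonneg m t u v s h1
  simp at this
  linarith

/-! ### Separation of variables in the emission light -/

lemma target_mul_K_mul_excitation (m : Medium) {a₁ b₁ a₂ b₂ a₃ b₃ : ℝ} (P : ℝ) (ha : 0 < a₃)
    (u v : EuclideanSpace ℝ (Fin 2)) (t s : ℝ) (y : Fin 3 → ℝ) :
    target a₁ b₁ a₂ b₂ a₃ b₃ P y * K m (bdryPoint u) y (t - s) * excitation m y s (bdryPoint v) =
      ∏ i, (![(Ioo a₁ b₁).indicator (profile m t (u 0) (v 0) s),
        (Ioo a₂ b₂).indicator (profile m t (u 1) (v 1) s),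
        (Ioo a₃ b₃).indicator fun z => P * (m.D * heat m (t - s) * heat m s *
          (vert m z (t - s) * vert m z s))] : Fin 3 → ℝ → ℝ) i (y i) := by
  rw [Fin.prod_univ_three]
  simp only [Matrix.cons_val_zero, Matrix.cons_val_one, Matrix.cons_val]
  by_cases hy : y ∈ cuboid a₁ b₁ a₂ b₂ a₃ b₃
  · obtain ⟨_, h0, h1, h2⟩ := id hy
    simp only [target, indicator_of_mem hy, indicator_of_mem h0, indicator_of_mem h1,
      indicator_of_mem h2]
    have hK : K m (bdryPoint u) y (t - s) = heat m (t - s)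
        * (Real.exp (-(u 0 - y 0) ^ 2 / (4 * m.D * (t - s)))
          * Real.exp (-(u 1 - y 1) ^ 2 / (4 * m.D * (t - s)))) * vert m (y 2) (t - s) := by
      rw [← Real.exp_add, ← add_div, ← neg_add]
      simp [K, heat, vert, bdryPoint]
    have hE : excitation m y s (bdryPoint v) = m.D * heat m s
        * (Real.exp (-(y 0 - v 0) ^ 2 / (4 * m.D * s))
          * Real.exp (-(y 1 - v 1) ^ 2 / (4 * m.D * s))) * vert m (y 2) s := by
      rw [← Real.exp_add, ← add_div, ← neg_add, vert_eq]
      simp [excitation, heat, bdryPoint, mul_div_assoc]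
    rw [hK, hE]
    simp only [profile]
    ring
  · rw [target, indicator_of_notMem hy, zero_mul, zero_mul]
    by_cases h0 : y 0 ∈ Ioo a₁ b₁
    · by_cases h1 : y 1 ∈ Ioo a₂ b₂
      · have h2 : y 2 ∉ Ioo a₃ b₃ := fun h2 => hy ⟨ha.trans h2.1, h0, h1, h2⟩
        rw [indicator_of_notMem h2, mul_zero]
      · rw [indicator_of_notMem h1, mul_zero, zero_mul]
    · rw [indicator_of_notMem h0, zero_mul, zero_mul]

lemma integral_indicator_Ioo {a b : ℝ} (hab : a ≤ b) (f : ℝ → ℝ) :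
    ∫ y, (Ioo a b).indicator f y = ∫ y in a..b, f y := by
  rw [integral_indicator measurableSet_Ioo, intervalIntegral.integral_of_le hab,
    integral_Ioc_eq_integral_Ioo]

lemma emission_eq (m : Medium) {a₁ b₁ a₂ b₂ a₃ b₃ t : ℝ} (P : ℝ) (h₁ : a₁ ≤ b₁) (h₂ : a₂ ≤ b₂)
    (ha : 0 < a₃) (h₃ : a₃ ≤ b₃) (ht : 0 ≤ t) (u v : EuclideanSpace ℝ (Fin 2)) :
    emission m (target a₁ b₁ a₂ b₂ a₃ b₃ P) (bdryPoint u) t (bdryPoint v) =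
      m.cf * (P * ∫ s in Ioo 0 t, weight m a₃ b₃ t s *
        ((∫ y in a₁..b₁, profile m t (u 0) (v 0) s y)
          * ∫ y in a₂..b₂, profile m t (u 1) (v 1) s y)) := by
  rw [emission, intervalIntegral.integral_of_le ht, integral_Ioc_eq_integral_Ioo,
    ← integral_const_mul P]
  congr 1
  refine congrArg _ (funext fun s => ?_)
  beta_reduce
  rw [setIntegral_eq_integral_of_forall_compl_eq_zero]
  · simp only [target_mul_K_mul_excitation m P ha]
    rw [integral_fintype_prod_volume_eq_prod, Fin.prod_univ_three]
    simp only [Matrix.cons_val_zero, Matrix.cons_val_one, Matrix.cons_val,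
      integral_indicator_Ioo h₁, integral_indicator_Ioo h₂, integral_indicator_Ioo h₃,
      intervalIntegral.integral_const_mul, weight]
    ring
  · intro y hy
    rw [target, indicator_of_notMem fun h => hy h.1, zero_mul, zero_mul]

/-! ### Differentiation under the time integral -/

lemma abs_intervalIntegral_le_abs {f : ℝ → ℝ} (hf : ∀ y, |f y| ≤ 1) (x : ℝ) :
    |∫ y in (0 : ℝ)..x, f y| ≤ |x| := by
  have := intervalIntegral.norm_integral_le_of_norm_le_const (a := 0) (b := x) (f := f) (C := 1)
    fun y _ => hf y
  simpa using this

/-- Differentiation under the integral sign of a weighted product of two primitives. -/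
lemma hasFDerivAt_integral_mul_primitives {μ : Measure ℝ} {w : ℝ → ℝ} (hw : Integrable w μ)
    {f g : ℝ → ℝ → ℝ} (hf : Measurable (Function.uncurry f)) (hg : Measurable (Function.uncurry g))
    (hfc : ∀ s, Continuous (f s)) (hgc : ∀ s, Continuous (g s))
    (hf1 : ∀ᵐ s ∂μ, ∀ y, |f s y| ≤ 1) (hg1 : ∀ᵐ s ∂μ, ∀ y, |g s y| ≤ 1) (z : ℝ × ℝ) :
    HasFDerivAt (fun z : ℝ × ℝ => ∫ s, w s * ((∫ y in (0 : ℝ)..z.1, f s y)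
        * ∫ y in (0 : ℝ)..z.2, g s y) ∂μ)
      ((∫ s, w s * (f s z.1 * ∫ y in (0 : ℝ)..z.2, g s y) ∂μ) • ContinuousLinearMap.fst ℝ ℝ ℝ +
        (∫ s, w s * ((∫ y in (0 : ℝ)..z.1, f s y) * g s z.2) ∂μ) •
          ContinuousLinearMap.snd ℝ ℝ ℝ) z := by
  have hF := measurable_intervalIntegral hf 0
  have hG := measurable_intervalIntegral hg 0
  have hfm : ∀ y, Measurable fun s => f s y := fun y => hf.of_uncurry_right
  have hgm : ∀ y, Measurable fun s => g s y := fun y => hg.of_uncurry_right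
  have hbound : ∀ {φ : ℝ → ℝ} {C : ℝ}, Measurable φ → (∀ᵐ s ∂μ, |φ s| ≤ C) →
      Integrable (fun s => w s * φ s) μ := fun hφ hC =>
    hw.mul_bdd hφ.aestronglyMeasurable hC
  have hA : Integrable (fun s => w s * (f s z.1 * ∫ y in (0 : ℝ)..z.2, g s y)) μ := by
    refine hbound (C := 1 * |z.2|) ((hfm _).mul (hG _)) ?_
    filter_upwards [hf1, hg1] with s h1 h2
    rw [abs_mul]
    exact mul_le_mul (h1 _) (abs_intervalIntegral_le_abs h2 _) (abs_nonneg _) zero_le_one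
  have hB : Integrable (fun s => w s * ((∫ y in (0 : ℝ)..z.1, f s y) * g s z.2)) μ := by
    refine hbound (C := |z.1| * 1) ((hF _).mul (hgm _)) ?_
    filter_upwards [hf1, hg1] with s h1 h2
    rw [abs_mul]
    exact mul_le_mul (abs_intervalIntegral_le_abs h1 _) (h2 _) (abs_nonneg _) (abs_nonneg _)
  have hC : Integrable (fun s => w s * ((∫ y in (0 : ℝ)..z.1, f s y)
      * ∫ y in (0 : ℝ)..z.2, g s y)) μ := by
    refine hbound (C := |z.1| * |z.2|) ((hF _).mul (hG _)) ?_
    filter_upwards [hf1, hg1] with s h1 h2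
    rw [abs_mul]
    exact mul_le_mul (abs_intervalIntegral_le_abs h1 _) (abs_intervalIntegral_le_abs h2 _)
      (abs_nonneg _) (abs_nonneg _)
  have key := hasFDerivAt_integral_of_dominated_of_fderiv_le (𝕜 := ℝ) (μ := μ)
    (F := fun (z : ℝ × ℝ) s => w s * ((∫ y in (0 : ℝ)..z.1, f s y) * ∫ y in (0 : ℝ)..z.2, g s y))
    (F' := fun (z : ℝ × ℝ) s =>
      (w s * (f s z.1 * ∫ y in (0 : ℝ)..z.2, g s y)) • ContinuousLinearMap.fst ℝ ℝ ℝ +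
        (w s * ((∫ y in (0 : ℝ)..z.1, f s y) * g s z.2)) • ContinuousLinearMap.snd ℝ ℝ ℝ)
    (x₀ := z) (s := Metric.ball z 1)
    -- On the unit ball about `z` each coordinate is at most `‖z‖ + 1`, hence so is each primitive.
    (bound := fun s => |w s| * ((‖z‖ + 1) * ‖ContinuousLinearMap.fst ℝ ℝ ℝ‖
      + (‖z‖ + 1) * ‖ContinuousLinearMap.snd ℝ ℝ ℝ‖))
    (Metric.ball_mem_nhds z one_pos)
    (Eventually.of_forall fun z' => hw.aestronglyMeasurable.mul
      ((hF _).mul (hG _)).aestronglyMeasurable)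
    hC ((hA.aestronglyMeasurable.smul_const _).add (hB.aestronglyMeasurable.smul_const _))
    ?_ (hw.abs.mul_const _) ?_
  · refine key.congr_fderiv ?_
    rw [integral_add (hA.smul_const _) (hB.smul_const _), integral_smul_const, integral_smul_const]
  · filter_upwards [hf1, hg1] with s h1 h2 z' hz'
    have hz : ‖z'‖ ≤ ‖z‖ + 1 := by
      have := norm_sub_norm_le z' z
      rw [Metric.mem_ball, dist_eq_norm] at hz'
      linarith
    have e1 : |z'.1| ≤ ‖z‖ + 1 := (norm_fst_le z').trans hz
    have e2 : |z'.2| ≤ ‖z‖ + 1 := (norm_snd_le z').trans hz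
    refine (norm_add_le _ _).trans ?_
    rw [norm_smul, norm_smul, Real.norm_eq_abs, Real.norm_eq_abs, abs_mul, abs_mul, abs_mul,
      abs_mul, mul_add, mul_assoc |w s|, mul_assoc |w s|]
    have i1 := (abs_intervalIntegral_le_abs h1 z'.1).trans e1
    have i2 := (abs_intervalIntegral_le_abs h2 z'.2).trans e2
    have j1 := h1 z'.1
    have j2 := h2 z'.2
    have k1 : |f s z'.1| * |∫ y in (0 : ℝ)..z'.2, g s y| ≤ ‖z‖ + 1 := by
      simpa using mul_le_mul j1 i2 (abs_nonneg _) zero_le_one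
    have k2 : |∫ y in (0 : ℝ)..z'.1, f s y| * |g s z'.2| ≤ ‖z‖ + 1 := by
      simpa using mul_le_mul i1 j2 (abs_nonneg _) ((abs_nonneg _).trans e1)
    exact add_le_add
      (mul_le_mul_of_nonneg_left (mul_le_mul_of_nonneg_right k1 (norm_nonneg _)) (abs_nonneg _))
      (mul_le_mul_of_nonneg_left (mul_le_mul_of_nonneg_right k2 (norm_nonneg _)) (abs_nonneg _))
  · refine ae_of_all _ fun s z' _ => ?_
    have d1 : HasFDerivAt (fun z : ℝ × ℝ => ∫ y in (0 : ℝ)..z.1, f s y)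
        (f s z'.1 • ContinuousLinearMap.fst ℝ ℝ ℝ) z' :=
      (intervalIntegral.integral_hasDerivAt_right ((hfc s).intervalIntegrable _ _)
        ((hfc s).stronglyMeasurableAtFilter _ _) (hfc s).continuousAt).comp_hasFDerivAt z' hasFDerivAt_fst
    have d2 : HasFDerivAt (fun z : ℝ × ℝ => ∫ y in (0 : ℝ)..z.2, g s y)
        (g s z'.2 • ContinuousLinearMap.snd ℝ ℝ ℝ) z' :=
      (intervalIntegral.integral_hasDerivAt_right ((hgc s).intervalIntegrable _ _)
        ((hgc s).stronglyMeasurableAtFilter _ _) (hgc s).continuousAt).comp_hasFDerivAt z' hasFDerivAt_snd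
    refine ((d1.mul d2).const_mul (w s)).congr_fderiv ?_
    refine ContinuousLinearMap.ext fun v => ?_
    simp
    ring

/-! ### Nearly triangular determinants and comparison of exponential rates -/

/-- If `σ i ≤ i` for all `i`, injectivity and strong induction force `σ` to fix every index. -/
lemma _root_.Equiv.Perm.exists_lt_of_ne_one {n : ℕ} {σ : Equiv.Perm (Fin n)} (hσ : σ ≠ 1) :
    ∃ i, i < σ i := by
  by_contra! h
  have key : ∀ k : ℕ, ∀ i : Fin n, i.val = k → σ i = i := by
    intro k
    induction k using Nat.strong_induction_on with
    | _ k ih =>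
      intro i hi
      by_contra hne
      have hlt : σ i < i := lt_of_le_of_ne (h i) hne
      exact hne (σ.injective (ih (σ i) (hi ▸ hlt) (σ i) rfl))
  exact hσ (Equiv.ext fun i => key i i rfl)

/-- A square matrix whose entries below the diagonal are small compared with its diagonal entries
is invertible. -/
lemma det_ne_zero_of_lower_le {n : ℕ} {N : Matrix (Fin n) (Fin n) ℝ} {C s g : ℝ} (hC : 1 ≤ C)
    (hs : 0 ≤ s) (hg : 0 ≤ g) (hN : ∀ i j, |N i j| ≤ C) (hlow : ∀ i j, j < i → |N i j| ≤ s)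
    (hdiag : ∀ i, g ≤ |N i i|) (h : n.factorial * (C ^ n * s) < g ^ n) : N.det ≠ 0 := by
  intro h0
  have hC0 : 0 ≤ C := zero_le_one.trans hC
  rw [Matrix.det_apply', ← Finset.add_sum_erase _ _ (Finset.mem_univ (1 : Equiv.Perm (Fin n)))] at h0
  have h1 : |∑ σ ∈ Finset.univ.erase (1 : Equiv.Perm (Fin n)),
      ((Equiv.Perm.sign σ : ℤ) : ℝ) * ∏ i, N (σ i) i| ≤ n.factorial * (C ^ n * s) := by
    refine (Finset.abs_sum_le_sum_abs _ _).trans ((Finset.sum_le_card_nsmul _ _ (C ^ n * s) ?_).trans ?_)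
    · intro σ hσ
      -- Row `σ i` exceeds column `i`, so this factor lies below the diagonal and supplies `s`; the
      -- other factors are bounded by `C`.
      obtain ⟨i, hi⟩ := Equiv.Perm.exists_lt_of_ne_one (Finset.ne_of_mem_erase hσ)
      rw [abs_mul]
      have : |((Equiv.Perm.sign σ : ℤ) : ℝ)| = 1 := by
        rcases Int.units_eq_one_or (Equiv.Perm.sign σ) with h | h <;> simp [h]
      rw [this, one_mul, Finset.abs_prod, ← Finset.mul_prod_erase _ _ (Finset.mem_univ i), mul_comm]
      refine mul_le_mul ?_ (hlow _ _ hi) (abs_nonneg _) (by positivity)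
      refine (Finset.prod_le_prod (fun _ _ => abs_nonneg _) fun j _ => hN _ _).trans ?_
      rw [Finset.prod_const]
      exact pow_le_pow_right₀ hC (by simp)
    · rw [nsmul_eq_mul]
      gcongr
      exact (Finset.card_le_univ _).trans (by simp [Fintype.card_perm])
  have h2 : g ^ n ≤ |∏ i, N i i| := by
    rw [Finset.abs_prod]
    calc g ^ n = ∏ _i : Fin n, g := by simp
      _ ≤ _ := Finset.prod_le_prod (fun _ _ => hg) fun i _ => hdiag i
  simp only [Equiv.Perm.sign_one, Units.val_one, Int.cast_one, one_mul, Equiv.Perm.coe_one, id] at h0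
  rw [eq_neg_of_add_eq_zero_left h0, abs_neg] at h2
  linarith

/-- With `x = 1 / t`, dividing by `t ^ n * exp (-(n * η / t))` reduces the claim to the decay of `x
^ n * exp (-(γ - n * η) * x)`. -/
lemma exists_mul_exp_lt (A : ℝ) {c γ η : ℝ} (hc : 0 < c) (n : ℕ) (h : n * η < γ) :
    ∃ t₀ > 0, ∀ t, 0 < t → t < t₀ →
      A * Real.exp (-(γ / t)) < (c * t * Real.exp (-(η / t))) ^ n := by
  have h1 : Tendsto (fun x : ℝ => A * (x ^ n * Real.exp (-(γ - n * η) * x))) atTop (𝓝 0) := by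
    have := tendsto_rpow_mul_exp_neg_mul_atTop_nhds_zero n (γ - n * η) (sub_pos.2 h)
    simpa using this.const_mul A
  obtain ⟨X, hX⟩ := eventually_atTop.1 (h1.eventually_lt_const (pow_pos hc n))
  refine ⟨1 / max X 1, by positivity, fun t ht htX => ?_⟩
  have hx : X ≤ 1 / t := by
    refine (le_max_left X 1).trans ?_
    rw [le_div_iff₀ ht]
    rw [lt_div_iff₀ (by positivity)] at htX
    linarith
  have h2 := hX _ hx
  have h3 : 0 < t ^ n * Real.exp (-(n * η / t)) := by positivity
  have h4 := mul_lt_mul_of_pos_right h2 h3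
  rw [mul_pow, mul_pow, ← Real.exp_nat_mul]
  have e1 : Real.exp (-(γ / t)) = Real.exp (-(γ - n * η) * (1 / t)) * Real.exp (-(n * η / t)) := by
    rw [← Real.exp_add]; congr 1; ring
  have e2 : (n : ℝ) * -(η / t) = -(n * η / t) := by ring
  rw [e1, e2]
  calc _ = A * ((1 / t) ^ n * Real.exp (-(γ - n * η) * (1 / t)))
        * (t ^ n * Real.exp (-(n * η / t))) := by
        have : (1 / t) ^ n * t ^ n = 1 := by
          rw [← mul_pow, one_div_mul_cancel ht.ne', one_pow]
        linear_combination (A * Real.exp (-(γ - n * η) * (1 / t)) * Real.exp (-(n * η / t))) *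
          (-this)
    _ < _ := by linarith

/-! ### The gradient of the emission light and the Jacobian matrix -/

lemma hasFDerivAt_integral_mul_integrals {μ : Measure ℝ} {w : ℝ → ℝ} (hw : Integrable w μ)
    {f g : ℝ → ℝ → ℝ} (hf : Measurable (Function.uncurry f)) (hg : Measurable (Function.uncurry g))
    (hfc : ∀ s, Continuous (f s)) (hgc : ∀ s, Continuous (g s))
    (hf1 : ∀ᵐ s ∂μ, ∀ y, |f s y| ≤ 1) (hg1 : ∀ᵐ s ∂μ, ∀ y, |g s y| ≤ 1) (c : ℝ)
    (p : EuclideanSpace ℝ (Fin 5)) :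
    HasFDerivAt (fun p : EuclideanSpace ℝ (Fin 5) => c * (p 4 * ∫ s, w s *
        ((∫ y in p 0..p 1, f s y) * ∫ y in p 2..p 3, g s y) ∂μ))
      (∑ j, (![-(c * (p 4 * ∫ s, w s * (f s (p 0) * ∫ y in p 2..p 3, g s y) ∂μ)),
        c * (p 4 * ∫ s, w s * (f s (p 1) * ∫ y in p 2..p 3, g s y) ∂μ),
        -(c * (p 4 * ∫ s, w s * ((∫ y in p 0..p 1, f s y) * g s (p 2)) ∂μ)),
        c * (p 4 * ∫ s, w s * ((∫ y in p 0..p 1, f s y) * g s (p 3)) ∂μ),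
        c * ∫ s, w s * ((∫ y in p 0..p 1, f s y) * ∫ y in p 2..p 3, g s y) ∂μ] : Fin 5 → ℝ) j •
          (EuclideanSpace.proj j : EuclideanSpace ℝ (Fin 5) →L[ℝ] ℝ)) p := by
  have hF := measurable_intervalIntegral hf 0
  have hG := measurable_intervalIntegral hg 0
  have hfm : ∀ y, Measurable fun s => f s y := fun y => hf.of_uncurry_right
  have hgm : ∀ y, Measurable fun s => g s y := fun y => hg.of_uncurry_right
  have hbound : ∀ {φ ψ : ℝ → ℝ} (C C' : ℝ), Measurable φ → Measurable ψ → (∀ᵐ s ∂μ, |φ s| ≤ C) →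
      (∀ᵐ s ∂μ, |ψ s| ≤ C') → Integrable (fun s => w s * (φ s * ψ s)) μ := by
    intro φ ψ C C' hφ hψ h1 h2
    refine hw.mul_bdd (c := C * C') (hφ.mul hψ).aestronglyMeasurable ?_
    filter_upwards [h1, h2] with s e1 e2
    rw [Real.norm_eq_abs, abs_mul]
    exact mul_le_mul e1 e2 (abs_nonneg _) ((abs_nonneg _).trans e1)
  have bF : ∀ x, ∀ᵐ s ∂μ, |∫ y in (0 : ℝ)..x, f s y| ≤ |x| := fun x => by
    filter_upwards [hf1] with s h using abs_intervalIntegral_le_abs h x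
  have bG : ∀ x, ∀ᵐ s ∂μ, |∫ y in (0 : ℝ)..x, g s y| ≤ |x| := fun x => by
    filter_upwards [hg1] with s h using abs_intervalIntegral_le_abs h x
  have bf : ∀ x, ∀ᵐ s ∂μ, |f s x| ≤ 1 := fun x => by filter_upwards [hf1] with s h using h x
  have bg : ∀ x, ∀ᵐ s ∂μ, |g s x| ≤ 1 := fun x => by filter_upwards [hg1] with s h using h x
  have sF : ∀ s a b, ∫ y in a..b, f s y = (∫ y in (0 : ℝ)..b, f s y) - ∫ y in (0 : ℝ)..a, f s y :=
    fun s a b => (intervalIntegral.integral_interval_sub_left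
      ((hfc s).intervalIntegrable _ _) ((hfc s).intervalIntegrable _ _)).symm
  have sG : ∀ s a b, ∫ y in a..b, g s y = (∫ y in (0 : ℝ)..b, g s y) - ∫ y in (0 : ℝ)..a, g s y :=
    fun s a b => (intervalIntegral.integral_interval_sub_left
      ((hgc s).intervalIntegrable _ _) ((hgc s).intervalIntegrable _ _)).symm
  set Q : ℝ × ℝ → ℝ := fun z => ∫ s, w s * ((∫ y in (0 : ℝ)..z.1, f s y)
        * ∫ y in (0 : ℝ)..z.2, g s y) ∂μ with hQ
  have iQ : ∀ x y, Integrable (fun s => w s * ((∫ y in (0 : ℝ)..x, f s y)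
        * ∫ y in (0 : ℝ)..y, g s y)) μ := fun x y =>
    hbound |x| |y| (hF x) (hG y) (bF x) (bG y)
  -- Inclusion-exclusion over the four corners reduces variable lower limits to primitives based at
  -- `0`.
  have eQ : ∀ x₀ x₁ y₀ y₁, ∫ s, w s * ((∫ y in x₀..x₁, f s y) * ∫ y in y₀..y₁, g s y) ∂μ =
      Q (x₁, y₁) - Q (x₀, y₁) - (Q (x₁, y₀) - Q (x₀, y₀)) := by
    intro x₀ x₁ y₀ y₁
    have iS : ∀ y, Integrable (fun s => w s * ((∫ y in (0 : ℝ)..x₁, f s y) * ∫ y in (0 : ℝ)..y, g s y)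
        - w s * ((∫ y in (0 : ℝ)..x₀, f s y) * ∫ y in (0 : ℝ)..y, g s y)) μ :=
      fun y => (iQ x₁ y).sub (iQ x₀ y)
    rw [← integral_sub (iQ _ _) (iQ _ _), ← integral_sub (iQ _ _) (iQ _ _),
      ← integral_sub (iS _) (iS _)]
    refine integral_congr_ae (ae_of_all _ fun s => ?_)
    simp only [sF s x₀ x₁, sG s y₀ y₁]
    ring
  have eA : ∀ x y₀ y₁, ∫ s, w s * (f s x * ∫ y in y₀..y₁, g s y) ∂μ =
      (∫ s, w s * (f s x * ∫ y in (0 : ℝ)..y₁, g s y) ∂μ) -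
        ∫ s, w s * (f s x * ∫ y in (0 : ℝ)..y₀, g s y) ∂μ := by
    intro x y₀ y₁
    rw [← integral_sub (hbound 1 |y₁| (hfm x) (hG y₁) (bf x) (bG y₁))
      (hbound 1 |y₀| (hfm x) (hG y₀) (bf x) (bG y₀))]
    refine integral_congr_ae (ae_of_all _ fun s => ?_)
    simp only [sG s y₀ y₁]
    ring
  have eB : ∀ x₀ x₁ y, ∫ s, w s * ((∫ y in x₀..x₁, f s y) * g s y) ∂μ =
      (∫ s, w s * ((∫ y in (0 : ℝ)..x₁, f s y) * g s y) ∂μ) -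
        ∫ s, w s * ((∫ y in (0 : ℝ)..x₀, f s y) * g s y) ∂μ := by
    intro x₀ x₁ y
    rw [← integral_sub (hbound |x₁| 1 (hF x₁) (hgm y) (bF x₁) (bg y))
      (hbound |x₀| 1 (hF x₀) (hgm y) (bF x₀) (bg y))]
    refine integral_congr_ae (ae_of_all _ fun s => ?_)
    simp only [sF s x₀ x₁]
    ring
  have dQ := hasFDerivAt_integral_mul_primitives hw hf hg hfc hgc hf1 hg1
  have dp : ∀ j, HasFDerivAt (fun p : EuclideanSpace ℝ (Fin 5) => p j)
      (EuclideanSpace.proj j : EuclideanSpace ℝ (Fin 5) →L[ℝ] ℝ) p := fun j =>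
    (EuclideanSpace.proj j : EuclideanSpace ℝ (Fin 5) →L[ℝ] ℝ).hasFDerivAt
  have dQp : ∀ i j, HasFDerivAt (fun p : EuclideanSpace ℝ (Fin 5) => Q (p i, p j))
      ((∫ s, w s * (f s (p i) * ∫ y in (0 : ℝ)..p j, g s y) ∂μ) •
          (EuclideanSpace.proj i : EuclideanSpace ℝ (Fin 5) →L[ℝ] ℝ) +
        (∫ s, w s * ((∫ y in (0 : ℝ)..p i, f s y) * g s (p j)) ∂μ) •
          (EuclideanSpace.proj j : EuclideanSpace ℝ (Fin 5) →L[ℝ] ℝ)) p := by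
    intro i j
    have h := HasFDerivAt.comp p (dQ (p i, p j)) ((dp i).prodMk (dp j))
    exact h.congr_fderiv (ContinuousLinearMap.ext fun _ => rfl)
  simp only [eQ]
  refine (((dp 4).mul (((dQp 1 3).sub (dQp 0 3)).sub ((dQp 1 2).sub (dQp 0 2)))).const_mul
    c).congr_fderiv ?_
  ext v
  rw [Fin.sum_univ_five, eA (p 0) (p 2) (p 3), eA (p 1) (p 2) (p 3), eB (p 0) (p 1) (p 2),
    eB (p 0) (p 1) (p 3)]
  simp only [add_apply, smul_apply, sub_apply, Pi.sub_apply, Matrix.cons_val_zero,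
    Matrix.cons_val_one, Matrix.cons_val, smul_eq_mul]
  ring

/-- The time integral of a product of two tangential factors against the vertical part. -/
noncomputable def pairing (m : Medium) (a₃ b₃ t : ℝ) (φ ψ : ℝ → ℝ) : ℝ :=
  ∫ s in Ioo 0 t, weight m a₃ b₃ t s * (φ s * ψ s)

lemma integrableOn_weight (m : Medium) {a₃ b₃ : ℝ} (t : ℝ) (ha : 0 < a₃) (hab : a₃ ≤ b₃) :
    Integrable (weight m a₃ b₃ t) (volume.restrict (Ioo 0 t)) := by
  obtain ⟨C, _, hC⟩ := exists_weight_le m ha hab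
  refine (integrable_const C).mono' (measurable_weight m a₃ b₃ t).aestronglyMeasurable ?_
  filter_upwards [ae_restrict_mem measurableSet_Ioo] with s hs
  rw [Real.norm_of_nonneg (weight_nonneg m ha hab hs)]
  exact hC t s hs

/-- The partial derivatives of the emission light with respect to `(a₁, b₁, a₂, b₂, P)`. -/
noncomputable def emissionGrad (m : Medium) (a₃ b₃ t : ℝ) (u v : EuclideanSpace ℝ (Fin 2))
    (p : EuclideanSpace ℝ (Fin 5)) : Fin 5 → ℝ :=
  ![-(m.cf * (p 4 * pairing m a₃ b₃ t (fun s => profile m t (u 0) (v 0) s (p 0))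
      fun s => ∫ y in p 2..p 3, profile m t (u 1) (v 1) s y)),
    m.cf * (p 4 * pairing m a₃ b₃ t (fun s => profile m t (u 0) (v 0) s (p 1))
      fun s => ∫ y in p 2..p 3, profile m t (u 1) (v 1) s y),
    -(m.cf * (p 4 * pairing m a₃ b₃ t (fun s => ∫ y in p 0..p 1, profile m t (u 0) (v 0) s y)
      fun s => profile m t (u 1) (v 1) s (p 2))),
    m.cf * (p 4 * pairing m a₃ b₃ t (fun s => ∫ y in p 0..p 1, profile m t (u 0) (v 0) s y)
      fun s => profile m t (u 1) (v 1) s (p 3)),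
    m.cf * pairing m a₃ b₃ t (fun s => ∫ y in p 0..p 1, profile m t (u 0) (v 0) s y)
      fun s => ∫ y in p 2..p 3, profile m t (u 1) (v 1) s y]

lemma hasFDerivAt_emission (m : Medium) {a₃ b₃ t : ℝ} (ha : 0 < a₃) (hab : a₃ ≤ b₃) (ht : 0 ≤ t)
    (u v : EuclideanSpace ℝ (Fin 2)) {p : EuclideanSpace ℝ (Fin 5)} (h₁ : p 0 < p 1)
    (h₂ : p 2 < p 3) :
    HasFDerivAt (fun p : EuclideanSpace ℝ (Fin 5) =>
        emission m (target (p 0) (p 1) (p 2) (p 3) a₃ b₃ (p 4)) (bdryPoint u) t (bdryPoint v))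
      (∑ j, emissionGrad m a₃ b₃ t u v p j •
        (EuclideanSpace.proj j : EuclideanSpace ℝ (Fin 5) →L[ℝ] ℝ)) p := by
  have hone : ∀ u v : ℝ, ∀ᵐ s ∂volume.restrict (Ioo 0 t), ∀ y, |profile m t u v s y| ≤ 1 := by
    intro u v
    filter_upwards [ae_restrict_mem measurableSet_Ioo] with s hs y
    rw [abs_of_nonneg (profile_nonneg _ _ _ _ _ _)]
    exact profile_le_one m hs y
  have key := hasFDerivAt_integral_mul_integrals (integrableOn_weight m t ha hab)
    (measurable_profile m t (u 0) (v 0)) (measurable_profile m t (u 1) (v 1))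
    (continuous_profile m t _ _) (continuous_profile m t _ _) (hone _ _) (hone _ _) m.cf p
  -- The product formula needs ordered endpoints: for reversed ones the target is empty while the
  -- interval integral changes sign. The strict inequalities persist near `p`.
  refine HasFDerivAt.congr_of_eventuallyEq key ?_
  have hc : ∀ j : Fin 5, Continuous fun p : EuclideanSpace ℝ (Fin 5) => p j := fun j =>
    (EuclideanSpace.proj j : EuclideanSpace ℝ (Fin 5) →L[ℝ] ℝ).continuous
  filter_upwards [(hc 0).continuousAt.eventually_lt (hc 1).continuousAt h₁,
    (hc 2).continuousAt.eventually_lt (hc 3).continuousAt h₂] with q hq₁ hq₂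
  exact emission_eq m (q 4) hq₁.le hq₂.le ha hab ht u v

lemma jacobianDet_eq (m : Medium) {a₃ b₃ t : ℝ} (ha : 0 < a₃) (hab : a₃ ≤ b₃) (ht : 0 ≤ t)
    (xd xs : Fin 5 → EuclideanSpace ℝ (Fin 2)) {p : EuclideanSpace ℝ (Fin 5)} (h₁ : p 0 < p 1)
    (h₂ : p 2 < p 3) :
    jacobianDet m a₃ b₃ t xd xs p =
      (Matrix.of fun l => emissionGrad m a₃ b₃ t (xd l) (xs l) p).det := by
  set M : Matrix (Fin 5) (Fin 5) ℝ :=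
    Matrix.of fun l => emissionGrad m a₃ b₃ t (xd l) (xs l) p with hM
  have h : HasFDerivAt (measurement m a₃ b₃ t xd xs)
      (LinearMap.toContinuousLinearMap (Matrix.toEuclideanLin M)) p := by
    rw [← hasFDerivWithinAt_univ, hasFDerivWithinAt_euclidean]
    intro l
    refine ((hasFDerivAt_emission m ha hab ht (xd l) (xs l) h₁ h₂).congr_fderiv ?_).hasFDerivWithinAt
    ext v
    simp [Matrix.toLpLin_apply, Matrix.mulVec, dotProduct, hM]
  rw [jacobianDet, h.fderiv]
  exact LinearMap.det_toLin (PiLp.basisFun 2 ℝ (Fin 5)) M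

/-! ### Upper and lower bounds for the Jacobian entries -/

lemma abs_pairing_le (m : Medium) {a₃ b₃ t C Φ Ψ : ℝ} {φ ψ : ℝ → ℝ} (ha : 0 < a₃) (hab : a₃ ≤ b₃)
    (ht : 0 < t) (ht1 : t ≤ 1) (hC : ∀ s ∈ Ioo 0 t, weight m a₃ b₃ t s ≤ C)
    (hφ : ∀ s ∈ Ioo 0 t, 0 ≤ φ s ∧ φ s ≤ Φ) (hψ : ∀ s ∈ Ioo 0 t, 0 ≤ ψ s ∧ ψ s ≤ Ψ) :
    |pairing m a₃ b₃ t φ ψ| ≤ C * (Φ * Ψ) := by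
  have hmid : t / 2 ∈ Ioo 0 t := ⟨by linarith, by linarith⟩
  have hC0 : 0 ≤ C := (weight_nonneg m ha hab hmid).trans (hC _ hmid)
  have hΦ : 0 ≤ Φ := (hφ _ hmid).1.trans (hφ _ hmid).2
  have hΨ : 0 ≤ Ψ := (hψ _ hmid).1.trans (hψ _ hmid).2
  have := norm_setIntegral_le_of_norm_le_const (μ := volume) (s := Ioo 0 t) (C := C * (Φ * Ψ))
    (f := fun s => weight m a₃ b₃ t s * (φ s * ψ s)) (by simp) fun s hs => by
      have h1 := hφ s hs
      have h2 := hψ s hs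
      have h3 := weight_nonneg m ha hab hs
      rw [Real.norm_of_nonneg (mul_nonneg h3 (mul_nonneg h1.1 h2.1))]
      exact mul_le_mul (hC s hs) (mul_le_mul h1.2 h2.2 h2.1 hΦ) (mul_nonneg h1.1 h2.1) hC0
  refine this.trans (mul_le_of_le_one_right (by positivity) ?_)
  simpa [Measure.real, ht.le] using ht1

lemma le_pairing (m : Medium) {a₃ b₃ h t φ₀ ψ₀ Φ Ψ : ℝ} {φ ψ : ℝ → ℝ} (ha : 0 < a₃) (hah : a₃ ≤ h)
    (hb : h ≤ b₃) (ht : 0 < t) (ht1 : t ≤ 1) (hβ : 2 * m.β * m.D * t ≤ a₃)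
    (hφm : Measurable φ) (hψm : Measurable ψ)
    (hφ : ∀ s ∈ Ioo 0 t, 0 ≤ φ s ∧ φ s ≤ Φ) (hψ : ∀ s ∈ Ioo 0 t, 0 ≤ ψ s ∧ ψ s ≤ Ψ)
    (hφ₀ : 0 ≤ φ₀) (hψ₀ : 0 ≤ ψ₀)
    (hφ' : ∀ s ∈ Icc (t / 4) (3 * t / 4), φ₀ ≤ φ s)
    (hψ' : ∀ s ∈ Icc (t / 4) (3 * t / 4), ψ₀ ≤ ψ s) :
    t / 2 * (m.D * heat m 1 ^ 2 * ((h - a₃) * Real.exp (-(2 * h ^ 2 / (m.D * t)))) * (φ₀ * ψ₀)) ≤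
      pairing m a₃ b₃ t φ ψ := by
  have hab := hah.trans hb
  have hsub : Icc (t / 4) (3 * t / 4) ⊆ Ioo 0 t := fun s hs =>
    ⟨by linarith [hs.1], by linarith [hs.2]⟩
  have hint : IntegrableOn (fun s => weight m a₃ b₃ t s * (φ s * ψ s)) (Ioo 0 t) := by
    refine (integrableOn_weight m t ha hab).mul_bdd (c := Φ * Ψ)
      (hφm.mul hψm).aestronglyMeasurable ?_
    filter_upwards [ae_restrict_mem measurableSet_Ioo] with s hs
    have h1 := hφ s hs
    have h2 := hψ s hs
    rw [Real.norm_of_nonneg (mul_nonneg h1.1 h2.1)]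
    exact mul_le_mul h1.2 h2.2 h2.1 (h1.1.trans h1.2)
  have hD := m.D_pos
  have hsubh := sub_nonneg.2 hah
  have step : ∫ s in Icc (t / 4) (3 * t / 4), (m.D * heat m 1 ^ 2 *
      ((h - a₃) * Real.exp (-(2 * h ^ 2 / (m.D * t)))) * (φ₀ * ψ₀)) ≤
      ∫ s in Icc (t / 4) (3 * t / 4), weight m a₃ b₃ t s * (φ s * ψ s) := by
    refine setIntegral_mono_on (integrableOn_const (by simp)) (hint.mono_set hsub) measurableSet_Icc fun s hs => ?_
    exact mul_le_mul (le_weight m ha hah hb ht ht1 hβ hs)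
      (mul_le_mul (hφ' s hs) (hψ' s hs) hψ₀ (hφ s (hsub hs)).1) (by positivity)
      (weight_nonneg m ha hab (hsub hs))
  have hmono : ∫ s in Icc (t / 4) (3 * t / 4), weight m a₃ b₃ t s * (φ s * ψ s) ≤
      pairing m a₃ b₃ t φ ψ := by
    refine setIntegral_mono_set hint ?_ (LE.le.eventuallyLE hsub)
    filter_upwards [ae_restrict_mem measurableSet_Ioo] with s hs
    exact mul_nonneg (weight_nonneg m ha hab hs) (mul_nonneg (hφ s hs).1 (hψ s hs).1)
  refine le_trans (le_of_eq ?_) (step.trans hmono)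
  rw [setIntegral_const, smul_eq_mul, Measure.real, Real.volume_Icc,
    ENNReal.toReal_ofReal (by linarith)]
  ring

/-- The point `y` is within `δ` of both `u` and `v`. -/
def CloseTo (u v δ y : ℝ) : Prop := |u - y| ≤ δ ∧ |y - v| ≤ δ

/-- The interval `[x₀, x₁]` contains a subinterval of length `ε` within `δ` of `u` and `v`. -/
def Covered (u v δ ε x₀ x₁ : ℝ) : Prop :=
  ∃ c, x₀ ≤ c ∧ c + ε ≤ x₁ ∧ ∀ y ∈ Icc c (c + ε), CloseTo u v δ y

lemma profile_bounds (m : Medium) (t u v y : ℝ) :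
    ∀ s ∈ Ioo 0 t, 0 ≤ profile m t u v s y ∧ profile m t u v s y ≤ 1 := fun _ hs =>
  ⟨profile_nonneg _ _ _ _ _ _, profile_le_one m hs y⟩

lemma integral_profile_bounds (m : Medium) (t u v : ℝ) {x₀ x₁ B : ℝ} (h : x₀ ≤ x₁)
    (hB : x₁ - x₀ ≤ B) : ∀ s ∈ Ioo 0 t,
      0 ≤ ∫ y in x₀..x₁, profile m t u v s y ∧ ∫ y in x₀..x₁, profile m t u v s y ≤ B := fun _ hs =>
  ⟨integral_profile_nonneg m t u v _ h, (integral_profile_le m hs h).trans hB⟩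

/-- The superfluous factor `ε ≤ 1` gives face values and integrals over an interval of length `ε`
the same lower bound. -/
lemma CloseTo.le_profile (m : Medium) {t u v y δ ε : ℝ} (ht : 0 < t) (hε : ε ≤ 1)
    (h : CloseTo u v δ y) : ∀ s ∈ Icc (t / 4) (3 * t / 4),
      ε * Real.exp (-(2 * δ ^ 2 / (m.D * t))) ≤ profile m t u v s y := fun _ hs =>
  (mul_le_of_le_one_left (Real.exp_pos _).le hε).trans (FDOT.le_profile m ht hs h.1 h.2)

lemma Covered.le_integral_profile (m : Medium) {t u v x₀ x₁ δ ε : ℝ} (ht : 0 < t) (hε : 0 ≤ ε)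
    (h : Covered u v δ ε x₀ x₁) : ∀ s ∈ Icc (t / 4) (3 * t / 4),
      ε * Real.exp (-(2 * δ ^ 2 / (m.D * t))) ≤ ∫ y in x₀..x₁, profile m t u v s y := by
  obtain ⟨c, h0, h1, hc⟩ := h
  intro s hs
  have := FDOT.le_integral_profile m ht hs h0 (le_add_of_nonneg_right hε) h1
    (fun y hy => (hc y hy).1) fun y hy => (hc y hy).2
  simpa using this

/-- The tangential direction in which the `j`-th parameter moves a face. -/
def axis : Fin 5 → Fin 2 := ![0, 0, 1, 1, 0]

lemma abs_emissionGrad_le (m : Medium) {a₃ b₃ t C B q : ℝ} {u v : EuclideanSpace ℝ (Fin 2)}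
    {p : EuclideanSpace ℝ (Fin 5)} (ha : 0 < a₃) (hab : a₃ ≤ b₃) (ht : 0 < t) (ht1 : t ≤ 1)
    (hC : ∀ s ∈ Ioo 0 t, weight m a₃ b₃ t s ≤ C) (hB : 1 ≤ B) (hq : 1 ≤ q)
    (h₁ : p 0 ≤ p 1) (h₂ : p 2 ≤ p 3) (h₁B : p 1 - p 0 ≤ B) (h₂B : p 3 - p 2 ≤ B) (hp : 0 ≤ p 4)
    (hpq : p 4 ≤ q) (j : Fin 5) :
    |emissionGrad m a₃ b₃ t u v p j| ≤ m.cf * (q * (C * (B * B))) := by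
  have hcf := m.cf_pos
  have hJ := fun w w' => integral_profile_bounds m t w w' h₁ h₁B
  have hK := fun w w' => integral_profile_bounds m t w w' h₂ h₂B
  have hf := fun w w' y s hs => (profile_bounds m t w w' y s hs).imp_right fun h => h.trans hB
  have fin : ∀ {r x : ℝ}, 0 ≤ r → r ≤ q → |x| ≤ C * (B * B) →
      |m.cf * (r * x)| ≤ m.cf * (q * (C * (B * B))) := by
    intro r x hr hrq hx
    rw [abs_mul, abs_mul, abs_of_pos hcf, abs_of_nonneg hr]
    gcongr
  have key := fun {φ ψ : ℝ → ℝ} => abs_pairing_le m (φ := φ) (ψ := ψ) (Φ := B) (Ψ := B)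
    ha hab ht ht1 hC
  fin_cases j
  · exact (abs_neg _).trans_le (fin hp hpq (key (hf _ _ _) (hK _ _)))
  · exact fin hp hpq (key (hf _ _ _) (hK _ _))
  · exact (abs_neg _).trans_le (fin hp hpq (key (hJ _ _) (hf _ _ _)))
  · exact fin hp hpq (key (hJ _ _) (hf _ _ _))
  · have := fin zero_le_one hq (key (hJ (u 0) (v 0)) (hK (u 1) (v 1)))
    rwa [one_mul] at this

/-- The integrand is evaluated at the moved face, where the source factor is exponentially small.
The index `4` is excluded because `P` moves no face; its entry in `axis` is a placeholder. -/
lemma abs_emissionGrad_le_exp (m : Medium) {a₃ b₃ t C B q ρ : ℝ} {u v : EuclideanSpace ℝ (Fin 2)}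
    {p : EuclideanSpace ℝ (Fin 5)} (ha : 0 < a₃) (hab : a₃ ≤ b₃) (ht : 0 < t) (ht1 : t ≤ 1)
    (hC0 : 0 ≤ C) (hC : ∀ s ∈ Ioo 0 t, weight m a₃ b₃ t s ≤ C) (hB : 1 ≤ B)
    (h₁ : p 0 ≤ p 1) (h₂ : p 2 ≤ p 3) (h₁B : p 1 - p 0 ≤ B) (h₂B : p 3 - p 2 ≤ B) (hp : 0 ≤ p 4)
    (hpq : p 4 ≤ q) (hρ : 0 ≤ ρ) (j : Fin 5) (hj : j ≠ 4) (hfar : ρ ≤ |v (axis j) - p j|) :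
    |emissionGrad m a₃ b₃ t u v p j| ≤
      m.cf * (q * (C * (B * B))) * Real.exp (-(ρ ^ 2 / (4 * m.D) / t)) := by
  have hcf := m.cf_pos
  have hq := hp.trans hpq
  rw [div_div]
  set E := Real.exp (-(ρ ^ 2 / (4 * m.D * t))) with hE
  have hE0 : 0 < E := Real.exp_pos _
  have hJ := fun w w' => integral_profile_bounds m t w w' h₁ h₁B
  have hK := fun w w' => integral_profile_bounds m t w w' h₂ h₂B
  have hf : ∀ w w' y, ρ ≤ |w' - y| → ∀ s ∈ Ioo 0 t,
      0 ≤ profile m t w w' s y ∧ profile m t w w' s y ≤ E := fun w w' y hy s hs =>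
    ⟨profile_nonneg _ _ _ _ _ _, profile_le_exp m hs hρ hy⟩
  have fin : ∀ {x : ℝ}, |x| ≤ C * (B * B * E) →
      |m.cf * (p 4 * x)| ≤ m.cf * (q * (C * (B * B))) * E := by
    intro x hx
    rw [abs_mul, abs_mul, abs_of_pos hcf, abs_of_nonneg hp]
    calc m.cf * (p 4 * |x|) ≤ m.cf * (q * (C * (B * B * E))) := by gcongr
      _ = _ := by ring
  have hBE : B * E ≤ B * B * E := by
    gcongr
    exact le_mul_of_one_le_left (by linarith) hB
  have keyA := fun {φ ψ : ℝ → ℝ} hφ hψ => (abs_pairing_le m (φ := φ) (ψ := ψ) (Φ := E) (Ψ := B)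
    ha hab ht ht1 hC hφ hψ).trans (mul_le_mul_of_nonneg_left ((mul_comm E B).trans_le hBE) hC0)
  have keyB := fun {φ ψ : ℝ → ℝ} hφ hψ => (abs_pairing_le m (φ := φ) (ψ := ψ) (Φ := B) (Ψ := E)
    ha hab ht ht1 hC hφ hψ).trans (mul_le_mul_of_nonneg_left hBE hC0)
  fin_cases j
  · exact (abs_neg _).trans_le (fin (keyA (hf _ _ _ hfar) (hK _ _)))
  · exact fin (keyA (hf _ _ _ hfar) (hK _ _))
  · exact (abs_neg _).trans_le (fin (keyB (hJ _ _) (hf _ _ _ hfar)))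
  · exact fin (keyB (hJ _ _) (hf _ _ _ hfar))
  · exact absurd rfl hj

/-- The source and the detector are close to a part of the cuboid on which the `j`-th partial
derivative of the emission light is concentrated. -/
def Concentrated (δ ε : ℝ) (u v : EuclideanSpace ℝ (Fin 2)) (p : EuclideanSpace ℝ (Fin 5)) :
    Fin 5 → Prop :=
  ![CloseTo (u 0) (v 0) δ (p 0) ∧ Covered (u 1) (v 1) δ ε (p 2) (p 3),
    CloseTo (u 0) (v 0) δ (p 1) ∧ Covered (u 1) (v 1) δ ε (p 2) (p 3),
    Covered (u 0) (v 0) δ ε (p 0) (p 1) ∧ CloseTo (u 1) (v 1) δ (p 2),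
    Covered (u 0) (v 0) δ ε (p 0) (p 1) ∧ CloseTo (u 1) (v 1) δ (p 3),
    Covered (u 0) (v 0) δ ε (p 0) (p 1) ∧ Covered (u 1) (v 1) δ ε (p 2) (p 3)]

/-- The six units in the exponent are two Gaussians, one per time interval, in each of the three
directions; each costs `exp (-(δ ^ 2 / (D * t)))`. The single `q` bounds both `p 4` and `1` from
below, since the derivative in `P` carries no factor `p 4`. -/
lemma le_abs_emissionGrad (m : Medium) {a₃ b₃ h t q δ ε : ℝ} {u v : EuclideanSpace ℝ (Fin 2)}
    {p : EuclideanSpace ℝ (Fin 5)} (ha : 0 < a₃) (hah : a₃ ≤ h) (hb : h ≤ b₃) (hδ : h ≤ δ)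
    (ht : 0 < t) (ht1 : t ≤ 1) (hβ : 2 * m.β * m.D * t ≤ a₃) (hε : 0 ≤ ε) (hε1 : ε ≤ 1)
    (hq : 0 ≤ q) (hq1 : q ≤ 1) (h₁ : p 0 ≤ p 1) (h₂ : p 2 ≤ p 3) (hp : q ≤ p 4) (j : Fin 5)
    (hj : Concentrated δ ε u v p j) :
    m.cf * (q * (1 / 2 * (m.D * heat m 1 ^ 2 * (h - a₃) * (ε * ε)))) * t *
      Real.exp (-(6 * δ ^ 2 / m.D / t)) ≤ |emissionGrad m a₃ b₃ t u v p j| := by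
  have hcf := m.cf_pos
  have hD := m.D_pos
  set e := Real.exp (-(2 * δ ^ 2 / (m.D * t))) with he
  have he0 : 0 < e := Real.exp_pos _
  have hsub := sub_nonneg.2 hah
  have heδ : e ≤ Real.exp (-(2 * h ^ 2 / (m.D * t))) := by
    rw [he, Real.exp_le_exp, neg_le_neg_iff]
    have := ha.trans_le hah
    gcongr
  have hsplit : Real.exp (-(6 * δ ^ 2 / m.D / t)) = e * (e * e) := by
    rw [he, ← Real.exp_add, ← Real.exp_add]
    congr 1
    field_simp
    ring
  have fin : ∀ {r x : ℝ}, q ≤ r →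
      t / 2 * (m.D * heat m 1 ^ 2 * ((h - a₃) * Real.exp (-(2 * h ^ 2 / (m.D * t))))
        * (ε * e * (ε * e))) ≤ x →
      m.cf * (q * (1 / 2 * (m.D * heat m 1 ^ 2 * (h - a₃) * (ε * ε)))) * t *
        Real.exp (-(6 * δ ^ 2 / m.D / t)) ≤ |m.cf * (r * x)| := by
    intro r x hr hx
    refine le_trans ?_ (le_abs_self _)
    have hx' := le_trans (show t / 2 * (m.D * heat m 1 ^ 2 * ((h - a₃) * e)
        * (ε * e * (ε * e))) ≤ _ by gcongr) hx
    rw [hsplit]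
    calc _ = m.cf * (q * (t / 2 * (m.D * heat m 1 ^ 2 * ((h - a₃) * e)
          * (ε * e * (ε * e))))) := by ring
      _ ≤ m.cf * (r * x) := by
        refine mul_le_mul_of_nonneg_left (mul_le_mul hr hx' (by positivity) (hq.trans hr)) hcf.le
  have key := fun {φ ψ : ℝ → ℝ} {Φ Ψ : ℝ} hφm hψm hφ hψ =>
    le_pairing m (φ := φ) (ψ := ψ) (Φ := Φ) (Ψ := Ψ) (φ₀ := ε * e) (ψ₀ := ε * e)
    ha hah hb ht ht1 hβ hφm hψm hφ hψ (mul_nonneg hε he0.le) (mul_nonneg hε he0.le)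
  have mf : ∀ w w' y, Measurable fun s => profile m t w w' s y := fun w w' y =>
    (measurable_profile m t w w').of_uncurry_right
  have mJ : ∀ w w' x₀ x₁, Measurable fun s => ∫ y in x₀..x₁, profile m t w w' s y :=
    fun w w' => measurable_intervalIntegral (measurable_profile m t w w')
  have bJ := fun w w' => integral_profile_bounds m t w w' h₁ le_rfl
  have bK := fun w w' => integral_profile_bounds m t w w' h₂ le_rfl
  have bf := profile_bounds m t
  fin_cases j
  · exact (fin hp (key (mf _ _ _) (mJ _ _ _ _) (bf _ _ _) (bK _ _) (hj.1.le_profile m ht hε1)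
      (hj.2.le_integral_profile m ht hε))).trans_eq (abs_neg _).symm
  · exact fin hp (key (mf _ _ _) (mJ _ _ _ _) (bf _ _ _) (bK _ _) (hj.1.le_profile m ht hε1)
      (hj.2.le_integral_profile m ht hε))
  · exact (fin hp (key (mJ _ _ _ _) (mf _ _ _) (bJ _ _) (bf _ _ _)
      (hj.1.le_integral_profile m ht hε) (hj.2.le_profile m ht hε1))).trans_eq (abs_neg _).symm
  · exact fin hp (key (mJ _ _ _ _) (mf _ _ _) (bJ _ _) (bf _ _ _)
      (hj.1.le_integral_profile m ht hε) (hj.2.le_profile m ht hε1))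
  · have := fin hq1 (key (mJ (u 0) (v 0) _ _) (mJ (u 1) (v 1) _ _) (bJ _ _) (bK _ _)
      (hj.1.le_integral_profile m ht hε) (hj.2.le_integral_profile m ht hε))
    rwa [one_mul] at this

/-! ### Positions of sources and detectors relative to the faces -/

section Geometry

variable {a b x₀ x₁ u v θ ε lo Λ κ : ℝ}

/-- The errors add up: `ε * (b - a)` from `θ`, and `ε` each from the moved face, the detector and
the length of the covered interval. Their sum is at most `3 * (Λ * ε)`. -/
lemma near_right (hlo : lo ≤ b - a) (hΛ : b - a + 1 ≤ Λ) (hlo0 : 0 < lo) (hκ : κ ≤ 1 / 2)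
    (hε : 0 < ε) (hεκ : 100 * (ε * Λ) ≤ κ * lo) (hx₀ : |x₀ - a| ≤ ε)
    (hx₁ : |x₁ - b| ≤ ε) (hv : v = (1 - θ) * a + θ * b) (hu : |v - u| ≤ ε) (hθ : |θ - 1| < ε) :
    κ * lo / 2 ≤ |v - x₀| ∧ CloseTo u v (3 * (Λ * ε)) x₁ ∧ Covered u v (3 * (Λ * ε)) ε x₀ x₁ := by
  have hκlo : κ * lo ≤ 1 / 2 * lo := by gcongr
  have hεL : ε * (b - a + 1) ≤ ε * Λ := by gcongr
  have hεL1 : 0 ≤ ε * (b - a) := mul_nonneg hε.le (by linarith)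
  have hvb : |v - b| ≤ ε * (b - a) := by
    rw [show v - b = (θ - 1) * (b - a) by rw [hv]; ring, abs_mul, abs_of_nonneg (by linarith :
      0 ≤ b - a)]
    exact mul_le_mul_of_nonneg_right hθ.le (by linarith)
  have hcomm : Λ * ε = ε * Λ := mul_comm _ _
  rw [abs_le] at *
  refine ⟨le_abs.2 (Or.inl (by linarith)), ⟨abs_le.2 ⟨by linarith, by linarith⟩,
    abs_le.2 ⟨by linarith, by linarith⟩⟩, x₁ - ε, by linarith, by linarith, fun y hy => ?_⟩
  exact ⟨abs_le.2 ⟨by linarith [hy.1, hy.2], by linarith [hy.1, hy.2]⟩,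
    abs_le.2 ⟨by linarith [hy.1, hy.2], by linarith [hy.1, hy.2]⟩⟩

lemma near_left (hlo : lo ≤ b - a) (hΛ : b - a + 1 ≤ Λ) (hlo0 : 0 < lo) (hκ : κ ≤ 1 / 2)
    (hε : 0 < ε) (hεκ : 100 * (ε * Λ) ≤ κ * lo) (hx₀ : |x₀ - a| ≤ ε)
    (hx₁ : |x₁ - b| ≤ ε) (hv : v = (1 - θ) * a + θ * b) (hu : |v - u| ≤ ε) (hθ : |θ| < ε) :
    κ * lo / 2 ≤ |v - x₁| ∧ CloseTo u v (3 * (Λ * ε)) x₀ ∧ Covered u v (3 * (Λ * ε)) ε x₀ x₁ := by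
  have hκlo : κ * lo ≤ 1 / 2 * lo := by gcongr
  have hεL : ε * (b - a + 1) ≤ ε * Λ := by gcongr
  have hεL1 : 0 ≤ ε * (b - a) := mul_nonneg hε.le (by linarith)
  have hva : |v - a| ≤ ε * (b - a) := by
    rw [show v - a = θ * (b - a) by rw [hv]; ring, abs_mul, abs_of_nonneg (by linarith :
      0 ≤ b - a)]
    exact mul_le_mul_of_nonneg_right hθ.le (by linarith)
  have hcomm : Λ * ε = ε * Λ := mul_comm _ _
  rw [abs_le] at *
  refine ⟨le_abs.2 (Or.inr (by linarith)), ⟨abs_le.2 ⟨by linarith, by linarith⟩,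
    abs_le.2 ⟨by linarith, by linarith⟩⟩, x₀, le_rfl, by linarith, fun y hy => ?_⟩
  exact ⟨abs_le.2 ⟨by linarith [hy.1, hy.2], by linarith [hy.1, hy.2]⟩,
    abs_le.2 ⟨by linarith [hy.1, hy.2], by linarith [hy.1, hy.2]⟩⟩

/-- The window for `θ` is widened by `ε` so that it also accommodates `θ₅₂`, which is known only to
lie within `ε` of `θ₅₁`. -/
lemma near_interior (hlo : lo ≤ b - a) (hΛ : b - a + 1 ≤ Λ) (hlo0 : 0 < lo)
    (hκ0 : 0 < κ) (hε : 0 < ε) (hεκ : 100 * (ε * Λ) ≤ κ * lo) (hx₀ : |x₀ - a| ≤ ε)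
    (hx₁ : |x₁ - b| ≤ ε) (hv : v = (1 - θ) * a + θ * b) (hu : |v - u| ≤ ε)
    (hθ : θ ∈ Icc (κ - ε) (1 - κ + ε)) :
    κ * lo / 2 ≤ |v - x₀| ∧ κ * lo / 2 ≤ |v - x₁| ∧ Covered u v (3 * (Λ * ε)) ε x₀ x₁ := by
  have hεL : ε * (b - a + 1) ≤ ε * Λ := by gcongr
  have hκL : κ * lo ≤ κ * (b - a) := by gcongr
  have hεL1 : 0 ≤ ε * (b - a) := mul_nonneg hε.le (by linarith)
  have hva : (κ - ε) * (b - a) ≤ v - a := by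
    rw [show v - a = θ * (b - a) by rw [hv]; ring]
    exact mul_le_mul_of_nonneg_right hθ.1 (by linarith)
  have hvb : (κ - ε) * (b - a) ≤ b - v := by
    rw [show b - v = (1 - θ) * (b - a) by rw [hv]; ring]
    exact mul_le_mul_of_nonneg_right (by linarith [hθ.2]) (by linarith)
  have hcomm : Λ * ε = ε * Λ := mul_comm _ _
  rw [sub_mul] at hva hvb
  rw [abs_le] at *
  refine ⟨le_abs.2 (Or.inl (by linarith)), le_abs.2 (Or.inr (by linarith)), v, by linarith,
    by linarith, fun y hy => ?_⟩
  exact ⟨abs_le.2 ⟨by linarith [hy.1, hy.2], by linarith [hy.1, hy.2]⟩,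
    abs_le.2 ⟨by linarith [hy.1, hy.2], by linarith [hy.1, hy.2]⟩⟩

end Geometry

/-! ### Triangularity and choice of constants -/

/-- The order `(b₁, a₂, a₁, b₂, P)` of the parameters in which the Jacobian matrix is
asymptotically upper triangular. -/
def paramOrder : Equiv.Perm (Fin 5) :=
  ⟨![1, 2, 0, 3, 4], ![2, 0, 1, 3, 4], by decide, by decide⟩

lemma jacobianDet_ne_zero_of_triangular (m : Medium) {a₃ b₃ t G c γ η : ℝ} (ha : 0 < a₃)
    (hab : a₃ ≤ b₃) (ht : 0 < t) {xd xs : Fin 5 → EuclideanSpace ℝ (Fin 2)}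
    {p : EuclideanSpace ℝ (Fin 5)} (h₁ : p 0 < p 1) (h₂ : p 2 < p 3) (hG : 1 ≤ G) (hc : 0 < c)
    (hle : ∀ l j, |emissionGrad m a₃ b₃ t (xd l) (xs l) p j| ≤ G)
    (hlow : ∀ i j, j < i → |emissionGrad m a₃ b₃ t (xd i) (xs i) p (paramOrder j)| ≤
      G * Real.exp (-(γ / t)))
    (hdiag : ∀ i, c * t * Real.exp (-(η / t)) ≤
      |emissionGrad m a₃ b₃ t (xd i) (xs i) p (paramOrder i)|)
    (h : (Nat.factorial 5 * (G ^ 5 * G)) * Real.exp (-(γ / t)) <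
      (c * t * Real.exp (-(η / t))) ^ 5) :
    jacobianDet m a₃ b₃ t xd xs p ≠ 0 := by
  rw [jacobianDet_eq m ha hab ht.le xd xs h₁ h₂]
  set M : Matrix (Fin 5) (Fin 5) ℝ :=
    Matrix.of fun l => emissionGrad m a₃ b₃ t (xd l) (xs l) p with hM
  have hN : (M.submatrix id paramOrder).det ≠ 0 := by
    refine det_ne_zero_of_lower_le (C := G) (s := G * Real.exp (-(γ / t)))
      (g := c * t * Real.exp (-(η / t))) hG (by positivity) (by positivity)
      (fun i j => hle i (paramOrder j)) hlow hdiag (lt_of_eq_of_lt ?_ h)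
    ring
  rw [Matrix.det_permute'] at hN
  exact right_ne_zero_of_mul hN

end FDOT

open FDOT Set

theorem mainTheorem4 (m : FDOT.Medium) (a b : Fin 2 → ℝ) (hab : ∀ j, a j < b j)
    (κ : ℝ) (hκ : 0 < κ) :
    ∃ ε > 0, ∀ (a₃ b₃ P : ℝ), 0 < a₃ → a₃ < b₃ → 0 < P → a₃ < ε →
      ∀ (θ : Fin 5 → Fin 2 → ℝ), FDOT.ThetaCondition ε θ →
        θ 3 0 ∈ Set.Icc κ (1 - κ) → θ 4 0 ∈ Set.Icc κ (1 - κ) →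
      ∀ (xs xd : Fin 5 → EuclideanSpace ℝ (Fin 2)),
        (∀ l, xs l = FDOT.sourcePoint a b (θ l)) → (∀ l, ‖xs l - xd l‖ < ε) →
      ∃ r > 0, ∃ t₀ > 0, ∀ t, 0 < t → t < t₀ →
        ∀ p ∈ Metric.ball (!₂[a 0, b 0, a 1, b 1, P] : EuclideanSpace ℝ (Fin 5)) r,
          FDOT.jacobianDet m a₃ b₃ t xd xs p ≠ 0 := by
  have hD := m.D_pos
  have hcf := m.cf_pos
  have hL0 : 0 < b 0 - a 0 := sub_pos.2 (hab 0)
  have hL1 : 0 < b 1 - a 1 := sub_pos.2 (hab 1)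
  obtain ⟨lo, hlo, hlo0, hlo1⟩ : ∃ lo, 0 < lo ∧ lo ≤ b 0 - a 0 ∧ lo ≤ b 1 - a 1 :=
    ⟨min (b 0 - a 0) (b 1 - a 1), lt_min hL0 hL1, min_le_left _ _, min_le_right _ _⟩
  obtain ⟨k, hk, hkκ, hk2⟩ : ∃ k, 0 < k ∧ k ≤ κ ∧ k ≤ 1 / 2 :=
    ⟨min κ (1 / 2), lt_min hκ (by norm_num), min_le_left _ _, min_le_right _ _⟩
  obtain ⟨Λ, hΛ⟩ : ∃ Λ, Λ = b 0 - a 0 + (b 1 - a 1) + 1 := ⟨_, rfl⟩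
  have hΛ0 : b 0 - a 0 + 1 ≤ Λ := by linarith
  have hΛ1 : b 1 - a 1 + 1 ≤ Λ := by linarith
  have hΛpos : 0 < Λ := by linarith
  -- The constant `100` makes `Λ * ε` small enough relative to the separation `k * lo / 2` for the
  -- rate inequality `hrate`; `k` and `lo` are simplified lower bounds for `κ` and the two side
  -- lengths.
  obtain ⟨ε, hεdef⟩ : ∃ ε, ε = k * lo / (100 * Λ) := ⟨_, rfl⟩
  have hε : 0 < ε := by rw [hεdef]; positivity
  have hεΛ : 100 * (ε * Λ) = k * lo := by rw [hεdef]; field_simp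
  have hεΛ' : ε ≤ ε * Λ := le_mul_of_one_le_right hε.le (by linarith)
  have hklo : k * lo ≤ 1 / 2 * lo := by gcongr
  have hε1 : ε ≤ 1 := by
    by_contra hcon
    nlinarith
  refine ⟨ε, hε, fun a₃ b₃ P ha hab₃ hP haε θ hθ hθ3 hθ4 xs xd hxs hxd => ?_⟩
  -- The slab `[a₃, h]` is the shallow part of the target; it is nondegenerate exactly because `a₃ <
  -- ε`.
  obtain ⟨h, hah, hhb, hhε⟩ : ∃ h, a₃ < h ∧ h ≤ b₃ ∧ h ≤ ε :=
    ⟨min b₃ ε, lt_min hab₃ haε, min_le_left _ _, min_le_right _ _⟩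
  obtain ⟨C, hC0, hC⟩ := exists_weight_le m ha hab₃.le
  obtain ⟨q, hq0, hqP, hq1⟩ : ∃ q, 0 < q ∧ q ≤ P / 2 ∧ q ≤ 1 :=
    ⟨min (P / 2) 1, lt_min (by linarith) one_pos, min_le_left _ _, min_le_right _ _⟩
  obtain ⟨r, hr, hrε, hrP⟩ : ∃ r, 0 < r ∧ r ≤ ε ∧ r ≤ P / 2 :=
    ⟨min ε (P / 2), lt_min hε (by linarith), min_le_left _ _, min_le_right _ _⟩
  set G := m.cf * ((P + P / 2 + 1) * (C * ((Λ + 2) * (Λ + 2)))) with hG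
  set c := m.cf * (q * (1 / 2 * (m.D * heat m 1 ^ 2 * (h - a₃) * (ε * ε)))) with hc
  have hheat : 0 < heat m 1 := by unfold heat; positivity
  have hc0 : 0 < c := by
    have := sub_pos.2 hah
    positivity
  -- With `δ = 3 * (Λ * ε)` and `k * lo / 2 = 50 * (ε * Λ)`, the inequality `5 * η < γ` becomes `270
  -- < 625`.
  have hrate : ((5 : ℕ) : ℝ) * (6 * (3 * (Λ * ε)) ^ 2 / m.D) < (k * lo / 2) ^ 2 / (4 * m.D) := by
    rw [mul_comm Λ ε, ← hεΛ]
    have : 0 < (ε * Λ) ^ 2 / m.D := by positivity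
    calc _ = 270 * ((ε * Λ) ^ 2 / m.D) := by push_cast; ring
      _ < 625 * ((ε * Λ) ^ 2 / m.D) := by linarith
      _ = _ := by field_simp; norm_num
  obtain ⟨t₁, ht₁, hsmall⟩ :=
    exists_mul_exp_lt (Nat.factorial 5 * (max G 1 ^ 5 * max G 1)) hc0 5 hrate
  have hβD : 0 < 2 * m.β * m.D + 1 := by
    have := m.β_nonneg
    positivity
  -- The last bound on `t` yields `2βDt ≤ a₃`, as `le_vert` requires throughout the target; the `+
  -- 1` keeps the denominator positive when `β = 0`.
  refine ⟨r, hr, min t₁ (min 1 (a₃ / (2 * m.β * m.D + 1))), by positivity, fun t ht htt p hp => ?_⟩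
  obtain ⟨htt₁, htt'⟩ := lt_min_iff.1 htt
  obtain ⟨ht1, htβ⟩ := lt_min_iff.1 htt'
  have hβ : 2 * m.β * m.D * t ≤ a₃ := by
    rw [lt_div_iff₀ hβD] at htβ
    linarith
  have hpj : ∀ j, |p j - (!₂[a 0, b 0, a 1, b 1, P] : EuclideanSpace ℝ (Fin 5)) j| ≤ r := fun j =>
    (PiLp.norm_apply_le (p - !₂[a 0, b 0, a 1, b 1, P]) j).trans (mem_ball_iff_norm.1 hp).le
  have hp0 : |p 0 - a 0| ≤ ε := (hpj 0).trans hrε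
  have hp1 : |p 1 - b 0| ≤ ε := (hpj 1).trans hrε
  have hp2 : |p 2 - a 1| ≤ ε := (hpj 2).trans hrε
  have hp3 : |p 3 - b 1| ≤ ε := (hpj 3).trans hrε
  have hp4 : |p 4 - P| ≤ P / 2 := (hpj 4).trans hrP
  have hxs' : ∀ l j, xs l j = (1 - θ l j) * a j + θ l j * b j := fun l j => by
    rw [hxs l]; rfl
  have hxd' : ∀ l j, |xs l j - xd l j| ≤ ε := fun l j =>
    (PiLp.norm_apply_le (xs l - xd l) j).trans (hxd l).le
  have hθ3' : θ 3 0 ∈ Icc (k - ε) (1 - k + ε) := ⟨by linarith [hθ3.1], by linarith [hθ3.2]⟩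
  have hθ4' : θ 4 0 ∈ Icc (k - ε) (1 - k + ε) := ⟨by linarith [hθ4.1], by linarith [hθ4.2]⟩
  have hθ4'' : θ 4 1 ∈ Icc (k - ε) (1 - k + ε) := by
    have := abs_lt.1 hθ.fifth
    exact ⟨by linarith [hθ4.1], by linarith [hθ4.2]⟩
  have right0 := fun l => near_right hlo0 hΛ0 hlo hk2 hε hεΛ.le hp0 hp1 (hxs' l 0) (hxd' l 0)
  have right1 := fun l => near_right hlo1 hΛ1 hlo hk2 hε hεΛ.le hp2 hp3 (hxs' l 1) (hxd' l 1)
  have left0 := fun l => near_left hlo0 hΛ0 hlo hk2 hε hεΛ.le hp0 hp1 (hxs' l 0) (hxd' l 0)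
  have left1 := fun l => near_left hlo1 hΛ1 hlo hk2 hε hεΛ.le hp2 hp3 (hxs' l 1) (hxd' l 1)
  have mid0 := fun l => near_interior hlo0 hΛ0 hlo hk hε hεΛ.le hp0 hp1 (hxs' l 0) (hxd' l 0)
  have mid1 := fun l => near_interior hlo1 hΛ1 hlo hk hε hεΛ.le hp2 hp3 (hxs' l 1) (hxd' l 1)
  obtain ⟨-, c00, -⟩ := right0 0 (hθ.first 0)
  obtain ⟨-, -, v01⟩ := right1 0 (hθ.first 1)
  obtain ⟨f10, -, v10⟩ := left0 1 (hθ.second 0)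
  obtain ⟨-, c11, -⟩ := left1 1 (hθ.second 1)
  obtain ⟨f20, c20, -⟩ := left0 2 hθ.third_fst
  obtain ⟨f21, -, v21⟩ := right1 2 hθ.third_snd
  obtain ⟨f30, f30', v30⟩ := mid0 3 hθ3'
  obtain ⟨f31, c31, -⟩ := right1 3 hθ.fourth_snd
  obtain ⟨f40, f40', v40⟩ := mid0 4 hθ4'
  obtain ⟨f41, f41', v41⟩ := mid1 4 hθ4''
  have hfar : ∀ i j, j < i → paramOrder j ≠ 4 ∧
      k * lo / 2 ≤ |xs i (axis (paramOrder j)) - p (paramOrder j)| := by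
    intro i j hij
    refine ⟨?_, ?_⟩
    · revert i j; decide
    · fin_cases i <;> fin_cases j <;> first
        | exact absurd hij (by decide)
        | exact f10 | exact f20 | exact f21 | exact f30 | exact f30' | exact f31
        | exact f40 | exact f40' | exact f41 | exact f41'
  have hconc : ∀ i, Concentrated (3 * (Λ * ε)) ε (xd i) (xs i) p (paramOrder i) := by
    intro i
    fin_cases i
    · exact ⟨c00, v01⟩
    · exact ⟨v10, c11⟩
    · exact ⟨c20, v21⟩
    · exact ⟨v30, c31⟩
    · exact ⟨v40, v41⟩
  rw [abs_le] at hp0 hp1 hp2 hp3 hp4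
  have h₁ : p 0 < p 1 := by linarith
  have h₂ : p 2 < p 3 := by linarith
  have h₁B : p 1 - p 0 ≤ Λ + 2 := by linarith
  have h₂B : p 3 - p 2 ≤ Λ + 2 := by linarith
  have hB : 1 ≤ Λ + 2 := by linarith
  have hp4' : 0 ≤ p 4 := by linarith
  have hp4q : p 4 ≤ P + P / 2 + 1 := by linarith
  refine jacobianDet_ne_zero_of_triangular m ha hab₃.le ht h₁ h₂ (le_max_right G 1) hc0
    (fun l j => ?_) (fun i j hij => ?_) (fun i => ?_) (hsmall t ht htt₁)
  · exact (abs_emissionGrad_le m ha hab₃.le ht ht1.le (hC t) hB (by linarith) h₁.le h₂.le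
      h₁B h₂B hp4' hp4q j).trans (le_max_left _ _)
  · obtain ⟨hne, hf⟩ := hfar i j hij
    refine (abs_emissionGrad_le_exp m ha hab₃.le ht ht1.le hC0.le (hC t) hB h₁.le h₂.le
      h₁B h₂B hp4' hp4q (by positivity) _ hne hf).trans ?_
    gcongr
    exact le_max_left _ _
  · exact le_abs_emissionGrad m ha hah.le hhb (by linarith) ht ht1.le hβ hε.le hε1 hq0.le hq1
      h₁.le h₂.le (by linarith) _ (hconc i)
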